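/- Let $\mathbb{T}=[-\pi,\pi]$ with periodic identification and let $H^m(\mathbb{T})$ be the real Sobolev space of $2\pi$-periodic functions whose weak derivatives up to order $m$ belong to $L^2$, with norm $\|f\|_{H^m}=\big(\sum_{k=0}^m\|f^{(k)}\|_{L^2}^2\big)^{1/2}$. Let $H$ be the Hilbert transform on $\mathbb{T}$, $$Hf(\theta)=\frac1{2\pi}\,\mathrm{P.V.}\!\int_{-\pi}^{\pi}\cot\frac{\theta-\phi}{2}\,f(\phi)\,d\phi .$$ Let $m>3$ be an integer and let $\eta_0\in H^m(\mathbb{T})$ (not necessarily odd). Then for every $T>0$ the linearized De Gregorio equation around the excited state $-\sin2\theta$, $$\partial_t\eta+L\eta=0,\qquad \partial_\theta v=H\eta,\qquad L\eta=\tfrac12\sin2\theta\,\partial_\theta\eta-\cos2\theta\,\eta+\sin2\theta\,H\eta-2\cos2\theta\,v,$$ with initial condition $\eta(0,\theta)=\eta_0(\theta)$ and gauge condition $v(t,0)=0$, has a unique classical solution $(\eta,v)$ on $[0,T]\times\mathbb{T}$. Here a classical solution is a pair of functions, $2\pi$-periodic in $\theta$, such that $\eta$ is $C^1$ in $(t,\theta)$,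 $v$ is differentiable in $\theta$, and the equations hold at every point. This solution satisfies $$\eta\in C([0,T];H^m(\mathbb{T}))\cap C^2([0,T];H^{m-2}(\mathbb{T})).$$ -/

import Mathlib

open Real Set Filter Topology MeasureTheory
open scoped ContDiff

noncomputable section

namespace DeGregorio

/-- Lebesgue measure on one period `(-π, π]` of the torus. -/
abbrev torusMeasure : Measure ℝ := volume.restrict (Ioc (-π) π)

/-- The real space `L²(𝕋)`. -/
abbrev L2T : Type := Lp ℝ 2 torusMeasure

/-- `g` is the weak derivative of `f` on the torus: integration by parts holds against every
smooth `2π`-periodic test function. -/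
def IsWeakDeriv (f g : ℝ → ℝ) : Prop :=
  ∀ φ : ℝ → ℝ, ContDiff ℝ ∞ φ → Function.Periodic φ (2 * π) →
    ∫ θ in (-π)..π, f θ * deriv φ θ = -∫ θ in (-π)..π, g θ * φ θ

theorem L2T.intervalIntegrable (f : L2T) : IntervalIntegrable (f : ℝ → ℝ) volume (-π) π := by
  rw [intervalIntegrable_iff_integrableOn_Ioc_of_le (by linarith [Real.pi_pos])]
  exact (Lp.memLp f).integrable (by norm_num)

theorem L2T.integral_congr {f g : ℝ → ℝ} (h : f =ᵐ[torusMeasure] g) (φ : ℝ → ℝ) :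
    ∫ θ in (-π)..π, f θ * φ θ = ∫ θ in (-π)..π, g θ * φ θ := by
  have hp : -π ≤ π := by linarith [Real.pi_pos]
  rw [intervalIntegral.integral_of_le hp, intervalIntegral.integral_of_le hp]
  refine MeasureTheory.integral_congr_ae ?_
  filter_upwards [h] with θ hθ
  rw [hθ]

theorem L2T.integral_add (f g : L2T) (φ : ℝ → ℝ) (hφ : Continuous φ) :
    ∫ θ in (-π)..π, (f + g : L2T) θ * φ θ
      = (∫ θ in (-π)..π, f θ * φ θ) + ∫ θ in (-π)..π, g θ * φ θ := by
  rw [L2T.integral_congr (Lp.coeFn_add f g) φ, ← intervalIntegral.integral_add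
    ((L2T.intervalIntegrable f).mul_continuousOn hφ.continuousOn)
    ((L2T.intervalIntegrable g).mul_continuousOn hφ.continuousOn)]
  simp only [Pi.add_apply, add_mul]

theorem L2T.integral_smul (c : ℝ) (f : L2T) (φ : ℝ → ℝ) :
    ∫ θ in (-π)..π, (c • f : L2T) θ * φ θ = c * ∫ θ in (-π)..π, f θ * φ θ := by
  rw [L2T.integral_congr (Lp.coeFn_smul c f) φ, ← intervalIntegral.integral_const_mul]
  simp only [Pi.smul_apply, smul_eq_mul, mul_assoc]

theorem L2T.integral_zero (φ : ℝ → ℝ) :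
    ∫ θ in (-π)..π, (0 : L2T) θ * φ θ = 0 := by
  have h := L2T.integral_smul 0 (0 : L2T) φ
  simpa using h

/-- The Sobolev space `H^m(𝕋)`. A function `f` is recorded with its weak derivatives, as the tuple
`(f, f', …, f^(m))` of elements of `L²(𝕋)`; since `f` determines its weak derivatives, these tuples
correspond bijectively to the functions in `H^m(𝕋)`. The norm that the `ℓ²`-product induces is
`(∑_{k ≤ m} ‖f^(k)‖²_{L²})^{1/2}`. -/
def sobolevSubmodule (m : ℕ) : Submodule ℝ (PiLp 2 (fun _ : Fin (m + 1) => L2T)) where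
  carrier := {F | ∀ k : Fin m, IsWeakDeriv (F k.castSucc) (F k.succ)}
  add_mem' := by
    intro F G hF hG k φ hφ hper
    have hφ' : Continuous (deriv φ) := hφ.continuous_deriv (by simp)
    have h1 := hF k φ hφ hper
    have h2 := hG k φ hφ hper
    have e1 := L2T.integral_add (F k.castSucc) (G k.castSucc) (deriv φ) hφ'
    have e2 := L2T.integral_add (F k.succ) (G k.succ) φ hφ.continuous
    simp only [PiLp.add_apply]
    rw [e1, e2, h1, h2]
    ring
  zero_mem' := by
    intro k φ _ _
    simp only [PiLp.zero_apply]
    rw [L2T.integral_zero, L2T.integral_zero, neg_zero]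
  smul_mem' := by
    intro c F hF k φ hφ hper
    have h1 := hF k φ hφ hper
    simp only [PiLp.smul_apply]
    rw [L2T.integral_smul, L2T.integral_smul, h1]
    ring

/-- `H^m(𝕋)` as a real normed space. -/
abbrev Sobolev (m : ℕ) : Type := ↥(sobolevSubmodule m)

/-- The function (defined almost everywhere on `(-π, π]`) underlying an element of `H^m(𝕋)`. -/
def Sobolev.toFun {m : ℕ} (f : Sobolev m) : ℝ → ℝ := (f.1 0 : L2T)

/-- `η ∈ C^k([0,T]; H^s(𝕋))`: the curve `t ↦ η(t, ·)` is, on `[0,T]`, given by a `C^k` curve in the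
normed space `H^s(𝕋)`. -/
def MemCkSobolev (k s : ℕ) (T : ℝ) (η : ℝ → ℝ → ℝ) : Prop :=
  ∃ U : ℝ → Sobolev s, ContDiffOn ℝ k U (Icc 0 T) ∧
    ∀ t ∈ Icc 0 T, (U t).toFun =ᵐ[torusMeasure] η t

/-- The truncated singular integral
`(1/2π) ∫_{ε < |θ - φ| < π} cot((θ - φ)/2) w(φ) dφ` (for `2π`-periodic `w`, integrating over the
period centred at `θ`). -/
def hilbertTrunc (w : ℝ → ℝ) (θ ε : ℝ) : ℝ :=
  1 / (2 * π) * ((∫ φ in (θ - π)..(θ - ε), Real.cot ((θ - φ) / 2) * w φ)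
    + ∫ φ in (θ + ε)..(θ + π), Real.cot ((θ - φ) / 2) * w φ)

/-- The principal value defining the Hilbert transform of `w` at `θ` exists and equals `h`. -/
def HasHilbertAt (w : ℝ → ℝ) (θ h : ℝ) : Prop :=
  Tendsto (hilbertTrunc w θ) (𝓝[>] 0) (𝓝 h)

/-- The Hilbert transform `Hw(θ) = (1/2π) P.V. ∫ cot((θ - φ)/2) w(φ) dφ` on the torus. -/
def hilbert (w : ℝ → ℝ) (θ : ℝ) : ℝ := limUnder (𝓝[>] 0) (hilbertTrunc w θ)

/-- The linearized operator
`Lη = ½ sin 2θ ∂_θ η - cos 2θ η + sin 2θ Hη - 2 cos 2θ v`. -/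
def linOp (η v : ℝ → ℝ) (θ : ℝ) : ℝ :=
  1 / 2 * sin (2 * θ) * deriv η θ - cos (2 * θ) * η θ + sin (2 * θ) * hilbert η θ
    - 2 * cos (2 * θ) * v θ

/-- `(η, v)` is a classical solution on `[0,T] × 𝕋` of `η_t + Lη = 0`, `∂_θ v = Hη` with
`η(0, ·) = η₀` and `v(t, 0) = 0`. Functions on the torus are `2π`-periodic functions on `ℝ`. -/
structure IsClassicalSolution {m : ℕ} (T : ℝ) (η₀ : Sobolev m) (η v : ℝ → ℝ → ℝ) : Prop where
  periodic_eta : ∀ t ∈ Icc 0 T, Function.Periodic (η t) (2 * π)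
  periodic_v : ∀ t ∈ Icc 0 T, Function.Periodic (v t) (2 * π)
  contDiffOn_eta : ContDiffOn ℝ 1 (fun p : ℝ × ℝ => η p.1 p.2) (Icc 0 T ×ˢ univ)
  evolution : ∀ t ∈ Icc 0 T, ∀ θ : ℝ,
    HasDerivWithinAt (fun s => η s θ) (-linOp (η t) (v t) θ) (Icc 0 T) t
  hasHilbert : ∀ t ∈ Icc 0 T, ∀ θ : ℝ, HasHilbertAt (η t) θ (hilbert (η t) θ)
  deriv_v : ∀ t ∈ Icc 0 T, ∀ θ : ℝ, HasDerivAt (v t) (hilbert (η t) θ) θ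
  gauge : ∀ t ∈ Icc 0 T, v t 0 = 0
  initial : η 0 =ᵐ[torusMeasure] η₀.toFun

end DeGregorio

end

/-! In Fourier variables, with `η = Re ∑ x_k e^{ikθ}`, the operator `L` sends mode `k` to modes `k ±
2` with coefficients `±k/4` plus bounded terms, and the gauge `v(t,0) = 0` adds a rank-one term. The
`±k/4` part is skew-adjoint up to a bounded error, because the multiplier `k` changes by only 2
between coupled modes. Conjugation by the Sobolev weights `(1 + |k|)^s` adds only bounded errors as
well. Hence every weighted `ℓ²` norm obeys `|d/dt ‖y‖²| ≤ 2C ‖y‖²`, without loss of derivatives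
(`energy_gen`).

Existence: with `k` truncated to `[-N, N]` the generators are bounded, their exponentials solve the
truncated problems, and the energy bounds do not depend on `N`. Two truncated generators differ by
`O(1/N)` once two weights are given up (`norm_wt_mul_gen_sub_le`). Duhamel's formula
(`norm_exp_sub_exp_le`) then gives convergence for data in a dense smoother space, and the uniform
bounds extend it to all data (`exists_limit_evolution`). The limit is continuous at level `m`, and
each time derivative costs one level, so it is `C²` at level `m - 2`.

Return to functions: since `m ≥ 4`, the series and its differentiated series converge absolutely.
The integrals `∫ cot(s/2) sin(ks) ds = π sign k` over `[0, π]` show that the principal-value Hilbert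
transform is the multiplier `-i sign k`, and `linOp_trigSeries` identifies the pointwise operator
with its Fourier form.

Uniqueness: the difference of two classical solutions is only `C¹`, so it is treated by a direct
`L²` estimate. It uses integration by parts, `‖Hw‖ ≤ ‖w‖`, the bound of `v` by `Hw` due to the gauge
(`energy_estimate`), and then Gronwall's argument. -/

noncomputable section

namespace DeGregorio

/-! ### Exponentials of bounded operators and their limits under uniform energy bounds. -/

section AbstractEvolution

variable {E : Type*} [NormedAddCommGroup E] [InnerProductSpace ℂ E] [CompleteSpace E]

theorem hasDerivAt_exp_smul_apply (A : E →L[ℂ] E) (y : E) (t : ℝ) :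
    HasDerivAt (fun s : ℝ => NormedSpace.exp (s • A) y) (A (NormedSpace.exp (t • A) y)) t := by
  have h := hasDerivAt_exp_smul_const' (𝕂 := ℝ) A t
  exact (((ContinuousLinearMap.apply ℂ E y).restrictScalars ℝ).hasFDerivAt.comp_hasDerivAt t h)

/-- The energy inequality makes `‖u‖² e^{-2Ct}` nonincreasing. The bound sees only the constant `C`
and not `‖A‖`, so it survives when the operators become unbounded in the limit. -/
theorem norm_exp_smul_apply_le_of_nonneg {A : E →L[ℂ] E} {C : ℝ}
    (hA : ∀ y, RCLike.re (inner ℂ y (A y)) ≤ C * ‖y‖ ^ 2) (y : E) {t : ℝ} (ht : 0 ≤ t) :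
    ‖NormedSpace.exp (t • A) y‖ ≤ Real.exp (C * t) * ‖y‖ := by
  set u : ℝ → E := fun s => NormedSpace.exp (s • A) y with hu
  have hd (s : ℝ) : HasDerivAt (fun s => ‖u s‖ ^ 2) (2 * RCLike.re (inner ℂ (u s) (A (u s)))) s := by
    have h1 := hasDerivAt_exp_smul_apply A y s
    have h2 := (RCLike.reCLM (K := ℂ)).hasFDerivAt.comp_hasDerivAt s (h1.inner ℂ h1)
    have e : (RCLike.reCLM (K := ℂ) ∘ fun t => inner ℂ (u t) (u t)) = fun s => ‖u s‖ ^ 2 := by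
      funext s
      simp [inner_self_eq_norm_sq_to_K, ← Complex.ofReal_pow]
    rw [hu] at e ⊢
    rw [e] at h2
    convert! h2 using 1
    simp only [map_add, RCLike.reCLM_apply]
    rw [← inner_conj_symm (A _) _, RCLike.conj_re]
    ring
  have hg (s : ℝ) : HasDerivAt (fun s => ‖u s‖ ^ 2 * Real.exp (-(2 * C) * s))
      (2 * RCLike.re (inner ℂ (u s) (A (u s))) * Real.exp (-(2 * C) * s)
        + ‖u s‖ ^ 2 * (Real.exp (-(2 * C) * s) * (-(2 * C)))) s :=
    (hd s).mul (by simpa using ((hasDerivAt_id s).const_mul (-(2 * C))).exp)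
  have anti := antitone_of_hasDerivAt_nonpos hg (fun s => by
    have := hA (u s)
    have he := Real.exp_pos (-(2 * C) * s)
    have : (2 * RCLike.re (inner ℂ (u s) (A (u s))) - 2 * (C * ‖u s‖ ^ 2))
      * Real.exp (-(2 * C) * s) ≤ 0 := mul_nonpos_of_nonpos_of_nonneg (by linarith) he.le
    simp only [Pi.zero_apply]
    linarith)
  have h0 := anti ht
  simp only [mul_zero, Real.exp_zero, mul_one] at h0
  have hu0 : u 0 = y := by simp [hu]
  rw [hu0] at h0
  have he : Real.exp (-(2 * C) * t) * (Real.exp (C * t)) ^ 2 = 1 := by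
    rw [← Real.exp_nat_mul, ← Real.exp_add]
    simp only [Nat.cast_ofNat, Real.exp_eq_one_iff]; ring
  have : ‖u t‖ ^ 2 ≤ (Real.exp (C * t) * ‖y‖) ^ 2 := by
    calc ‖u t‖ ^ 2 = (‖u t‖ ^ 2 * Real.exp (-(2 * C) * t)) * (Real.exp (C * t)) ^ 2 := by
          rw [mul_assoc, he, mul_one]
      _ ≤ ‖y‖ ^ 2 * (Real.exp (C * t)) ^ 2 := by gcongr
      _ = _ := by ring
  exact le_of_sq_le_sq this (by positivity)

theorem norm_exp_smul_le {A : E →L[ℂ] E} {C : ℝ}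
    (hA : ∀ y, |RCLike.re (inner ℂ y (A y))| ≤ C * ‖y‖ ^ 2) (t : ℝ) :
    ‖NormedSpace.exp (t • A)‖ ≤ Real.exp (C * |t|) := by
  refine ContinuousLinearMap.opNorm_le_bound _ (Real.exp_pos _).le (fun y => ?_)
  rcases le_total 0 t with ht | ht
  · rw [abs_of_nonneg ht]
    exact norm_exp_smul_apply_le_of_nonneg (fun y => (le_abs_self _).trans (hA y)) y ht
  · rw [abs_of_nonpos ht]
    have h := norm_exp_smul_apply_le_of_nonneg (A := -A) (C := C) (fun y => by
      have := neg_le_of_abs_le (hA y)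
      simp only [neg_apply, inner_neg_right, map_neg]
      linarith) y (t := -t) (by linarith)
    rwa [smul_neg, neg_smul, neg_neg] at h

theorem exp_smul_apply_of_intertwine {A A' W : E →L[ℂ] E} (h : ∀ y, A (W y) = W (A' y)) (t : ℝ)
    (y : E) : NormedSpace.exp (t • A) (W y) = W (NormedSpace.exp (t • A') y) := by
  have hs : SemiconjBy W (t • A') (t • A) := by
    ext y
    simp [h]
  let _ : NormedAlgebra ℚ (E →L[ℂ] E) := NormedAlgebra.restrictScalars ℚ ℂ _
  have := hs.exp_right
  exact (congrArg (fun T : E →L[ℂ] E => T y) this).symm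

/-- Duhamel's estimate for the difference of two evolutions. -/
theorem norm_exp_sub_exp_le {A B B' W : E →L[ℂ] E} {C C' : ℝ} (hC : 0 ≤ C) (hC' : 0 ≤ C')
    (hA : ∀ t : ℝ, ‖NormedSpace.exp (t • A)‖ ≤ Real.exp (C * |t|))
    (hB' : ∀ t : ℝ, ‖NormedSpace.exp (t • B')‖ ≤ Real.exp (C' * |t|))
    (h : ∀ y, B (W y) = W (B' y)) {R t : ℝ} (ht : |t| ≤ R) (z : E) :
    ‖NormedSpace.exp (t • A) (W z) - NormedSpace.exp (t • B) (W z)‖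
      ≤ Real.exp (C * R) * Real.exp (C' * R) * ‖(A - B) * W‖ * ‖z‖ * R := by
  -- The interpolant runs from `exp(tA) W z` at `s = 0` to `exp(tB) W z` at `s = t`, so the mean
  -- value inequality for `g` bounds the difference.
  set g : ℝ → E := fun s => NormedSpace.exp ((t - s) • A) (NormedSpace.exp (s • B) (W z)) with hg
  set g' : ℝ → E := fun s =>
    NormedSpace.exp ((t - s) • A) ((B - A) (NormedSpace.exp (s • B) (W z))) with hg'
  have hd (s : ℝ) : HasDerivAt g (g' s) s := by
    have h1 : HasDerivAt (fun s : ℝ => (NormedSpace.exp ((t - s) • A) : E →L[ℂ] E))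
        (-(NormedSpace.exp ((t - s) • A) * A)) s := by
      have := (hasDerivAt_exp_smul_const (𝕂 := ℝ) A (t - s)).scomp s
        ((hasDerivAt_id s).const_sub t)
      simpa [Function.comp_def] using this
    have h2 := hasDerivAt_exp_smul_apply B (W z) s
    have h1r := ((ContinuousLinearMap.restrictScalarsL ℂ E E ℝ ℝ).hasFDerivAt.comp_hasDerivAt s h1)
    have h3 := h1r.clm_apply h2
    convert! h3 using 1
    simp [hg', sub_eq_neg_add]
  have hR : 0 ≤ R := (abs_nonneg t).trans ht
  have hb (s : ℝ) (hs : s ∈ uIcc 0 t) :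
      ‖g' s‖ ≤ Real.exp (C * R) * Real.exp (C' * R) * ‖(A - B) * W‖ * ‖z‖ := by
    have hs1 : |s| ≤ R ∧ |t - s| ≤ R := by
      rcases le_total 0 t with h0 | h0
      · rw [uIcc_of_le h0] at hs
        rw [abs_of_nonneg h0] at ht
        rw [abs_of_nonneg hs.1, abs_of_nonneg (by linarith [hs.2])]
        exact ⟨by linarith [hs.2], by linarith [hs.1]⟩
      · rw [uIcc_of_ge h0] at hs
        rw [abs_of_nonpos h0] at ht
        rw [abs_of_nonpos hs.2, abs_of_nonpos (by linarith [hs.1])]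
        exact ⟨by linarith [hs.1], by linarith [hs.2]⟩
    -- Pulling `W` to the left through `exp(sB)` leaves `(A - B) W`, which is small in norm even
    -- where `A - B` is not.
    have e : (B - A) (NormedSpace.exp (s • B) (W z))
        = -(((A - B) * W) (NormedSpace.exp (s • B') z)) := by
      rw [exp_smul_apply_of_intertwine h]
      simp
    rw [hg']
    simp only
    rw [e, map_neg, norm_neg]
    calc _ ≤ ‖NormedSpace.exp ((t - s) • A)‖ * (‖(A - B) * W‖
            * (‖NormedSpace.exp (s • B')‖ * ‖z‖)) := by
          refine (ContinuousLinearMap.le_opNorm _ _).trans ?_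
          gcongr
          refine (ContinuousLinearMap.le_opNorm _ _).trans ?_
          gcongr
          exact ContinuousLinearMap.le_opNorm _ _
      _ ≤ Real.exp (C * R) * (‖(A - B) * W‖ * (Real.exp (C' * R) * ‖z‖)) := by
          gcongr
          · exact (hA _).trans (Real.exp_le_exp.2 (by gcongr; exact hs1.2))
          · exact (hB' _).trans (Real.exp_le_exp.2 (by gcongr; exact hs1.1))
      _ = _ := by ring
  have := (convex_uIcc (0 : ℝ) t).norm_image_sub_le_of_norm_hasDerivWithin_le (f := g) (f' := g')
    (fun s _ => (hd s).hasDerivWithinAt) hb right_mem_uIcc left_mem_uIcc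
  simp only [hg, sub_zero, sub_self, zero_smul, NormedSpace.exp_zero,
    one_apply_eq_self, zero_sub, norm_neg, Real.norm_eq_abs] at this
  refine this.trans ?_
  gcongr

/-- The uniform exponential bounds make the evolutions equicontinuous in the initial datum, so the
Cauchy property need only be checked on the dense range of `W`, where Duhamel's estimate applies. -/
theorem exists_limit_evolution {A A' : ℕ → E →L[ℂ] E} {W : E →L[ℂ] E} {C C' : ℝ}
    (hA : ∀ N y, |RCLike.re (inner ℂ y (A N y))| ≤ C * ‖y‖ ^ 2)
    (hA' : ∀ N y, |RCLike.re (inner ℂ y (A' N y))| ≤ C' * ‖y‖ ^ 2)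
    (hC : 0 ≤ C) (hC' : 0 ≤ C')
    (hAW : ∀ N y, A N (W y) = W (A' N y)) (hW : DenseRange W)
    (hcauchy : CauchySeq fun N => A N * W) (y₀ : E) :
    ∃ y : ℝ → E, Continuous y ∧ y 0 = y₀ ∧
      (∀ R : ℝ, TendstoUniformlyOn (fun N (t : ℝ) => NormedSpace.exp (t • A N) y₀) y atTop
        (Icc (-R) R)) := by
  have hE (N : ℕ) (t : ℝ) := norm_exp_smul_le (hA N) t
  have hE' (N : ℕ) (t : ℝ) := norm_exp_smul_le (hA' N) t
  have key (R : ℝ) : UniformCauchySeqOn (fun N (t : ℝ) => NormedSpace.exp (t • A N) y₀) atTop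
      (Icc (-R) R) := by
    rw [Metric.uniformCauchySeqOn_iff]
    intro ε hε
    -- Each of the two evolutions of the remainder `y₀ - W z` then costs less than `ε/4`, which
    -- leaves `ε/2` for the Duhamel term.
    obtain ⟨z, hz⟩ := hW.exists_dist_lt y₀ (ε := ε / (4 * Real.exp (C * |R|)))
      (by positivity)
    rw [dist_eq_norm, lt_div_iff₀ (by positivity)] at hz
    set K := Real.exp (C * |R|) * Real.exp (C' * |R|) * ‖z‖ * |R| + 1 with hK
    have hKpos : 0 < K := by positivity
    obtain ⟨N₀, hN₀⟩ := Metric.cauchySeq_iff.1 hcauchy (ε / (2 * K)) (by positivity)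
    refine ⟨N₀, fun M hM N hN t ht => ?_⟩
    have htR : |t| ≤ |R| := (abs_le.2 ht).trans (le_abs_self R)
    have h1 := norm_exp_sub_exp_le hC hC' (hE M) (hE' N) (hAW N) htR z
    have h2 := hN₀ M hM N hN
    rw [dist_eq_norm, ← sub_mul, lt_div_iff₀ (by positivity)] at h2
    have h3 (N : ℕ) : ‖NormedSpace.exp (t • A N) (y₀ - W z)‖
        ≤ Real.exp (C * |R|) * ‖y₀ - W z‖ := by
      refine (ContinuousLinearMap.le_opNorm _ _).trans ?_
      gcongr
      exact (hE N t).trans (Real.exp_le_exp.2 (by gcongr))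
    have e : NormedSpace.exp (t • A M) y₀ - NormedSpace.exp (t • A N) y₀
        = NormedSpace.exp (t • A M) (y₀ - W z) - NormedSpace.exp (t • A N) (y₀ - W z)
          + (NormedSpace.exp (t • A M) (W z) - NormedSpace.exp (t • A N) (W z)) := by
      simp only [map_sub]; abel
    rw [dist_eq_norm, e]
    have h4 : ‖NormedSpace.exp (t • A M) (W z) - NormedSpace.exp (t • A N) (W z)‖ < ε / 2 := by
      refine h1.trans_lt ?_
      calc _ = ‖(A M - A N) * W‖ * (K - 1) := by rw [hK]; ring
        _ ≤ ‖(A M - A N) * W‖ * K := by gcongr; linarith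
        _ < ε / 2 := by linarith
    refine (norm_add_le _ _).trans_lt ?_
    have h5 := norm_sub_le (NormedSpace.exp (t • A M) (y₀ - W z))
      (NormedSpace.exp (t • A N) (y₀ - W z))
    linarith [h3 M, h3 N]
  have hlim (t : ℝ) : ∃ l, Tendsto (fun N => NormedSpace.exp (t • A N) y₀) atTop (𝓝 l) :=
    cauchySeq_tendsto_of_complete ((key |t|).cauchySeq (abs_le.1 le_rfl))
  choose y hy using hlim
  have hunif (R : ℝ) := (key R).tendstoUniformlyOn_of_tendsto (fun t _ => hy t)
  refine ⟨y, ?_, ?_, hunif⟩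
  · refine continuous_iff_continuousAt.2 fun t => ?_
    have hc := (hunif (|t| + 1)).continuousOn (Frequently.of_forall fun N s _ =>
      (hasDerivAt_exp_smul_apply (A N) y₀ s).continuousAt.continuousWithinAt)
    refine hc.continuousAt (Icc_mem_nhds ?_ ?_)
    · linarith [neg_abs_le t]
    · linarith [le_abs_self t]
  · have h0 := hy 0
    simp only [zero_smul, NormedSpace.exp_zero, one_apply_eq_self] at h0
    exact tendsto_nhds_unique h0 tendsto_const_nhds

/-- Only the products `V A_N` need converge in norm. The derivatives of `V exp(sA_N) y₀` then
converge uniformly on compact time intervals, and differentiation passes to the limit. -/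
theorem hasDerivAt_of_limit_evolution {A : ℕ → E →L[ℂ] E} {V K : E →L[ℂ] E} {y₀ : E} {y : ℝ → E}
    (hy : ∀ R : ℝ, TendstoUniformlyOn (fun N (t : ℝ) => NormedSpace.exp (t • A N) y₀) y atTop
        (Icc (-R) R)) (hyc : Continuous y)
    (hK : Tendsto (fun N => V * A N) atTop (𝓝 K)) (t : ℝ) :
    HasDerivAt (fun s => V (y s)) (K (y t)) t := by
  refine hasDerivAt_of_tendstoUniformlyOn (l := atTop) (s := Ioo (-(|t| + 1)) (|t| + 1))
    (f := fun N s => V (NormedSpace.exp (s • A N) y₀)) (g' := fun s => K (y s))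
    (f' := fun N s => V (A N (NormedSpace.exp (s • A N) y₀))) isOpen_Ioo ?_ ?_ ?_ ?_
  · have hu := (hy (|t| + 1)).mono Ioo_subset_Icc_self
    obtain ⟨B, hB⟩ := (isCompact_Icc (a := -(|t| + 1)) (b := |t| + 1)).exists_bound_of_continuousOn
      hyc.continuousOn
    rw [Metric.tendstoUniformlyOn_iff] at hu ⊢
    intro ε hε
    have hB0 : 0 ≤ B := (norm_nonneg _).trans (hB 0 ⟨by linarith [abs_nonneg t],
      by linarith [abs_nonneg t]⟩)
    have h1 := Metric.tendsto_nhds.1 hK (ε / (2 * (B + 1))) (by positivity)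
    filter_upwards [h1, hu 1 one_pos, hu (ε / (2 * (‖K‖ + 1))) (by positivity)]
      with N hN1 hN2 hN3 s hs
    have h2 := hN2 s hs
    have h3 := hN3 s hs
    set v := NormedSpace.exp (s • A N) y₀
    rw [dist_comm, dist_eq_norm, lt_div_iff₀ (by positivity)] at hN1
    rw [dist_eq_norm] at h2 h3 ⊢
    rw [lt_div_iff₀ (by positivity)] at h3
    have hv : ‖v‖ ≤ B + 1 := by
      have := norm_sub_norm_le v (y s)
      rw [norm_sub_rev] at this
      linarith [hB s (Ioo_subset_Icc_self hs)]
    have e : K (y s) - V (A N v) = K (y s - v) + (K - V * A N) v := by simp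
    rw [e]
    have h4 : ‖K (y s - v)‖ ≤ ‖y s - v‖ * (‖K‖ + 1) :=
      (K.le_opNorm _).trans (by rw [mul_comm]; gcongr; linarith)
    have h5 : ‖(K - V * A N) v‖ ≤ ‖K - V * A N‖ * (B + 1) :=
      ((K - V * A N).le_opNorm _).trans (by gcongr)
    linarith [norm_add_le (K (y s - v)) ((K - V * A N) v)]
  · exact Eventually.of_forall fun N s _ =>
      (V.restrictScalars ℝ).hasFDerivAt.comp_hasDerivAt s (hasDerivAt_exp_smul_apply (A N) y₀ s)
  · intro s hs
    exact (V.continuous.tendsto _).comp ((hy (|t| + 1)).tendsto_at (Ioo_subset_Icc_self hs))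
  · exact ⟨by linarith [neg_abs_le t], by linarith [le_abs_self t]⟩

/-- If `W ∘ u` has derivative `W ∘ g` with `W` injective and `g` continuous, then `u' = g`. -/
theorem hasDerivAt_of_injective_comp {F : Type*} [NormedAddCommGroup F] [NormedSpace ℝ F]
    {G : Type*} [NormedAddCommGroup G] [NormedSpace ℝ G] [CompleteSpace F] [CompleteSpace G]
    {W : F →L[ℝ] G} (hW : Function.Injective W) {u g : ℝ → F} (hg : Continuous g)
    (h : ∀ t, HasDerivAt (fun s => W (u s)) (W (g t)) t) (t : ℝ) : HasDerivAt u (g t) t := by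
  -- The fundamental theorem of calculus holds after applying `W`; injectivity removes `W` from the
  -- integral equation, which can then be differentiated.
  have hu : u = fun t => u 0 + ∫ s in (0 : ℝ)..t, g s := by
    funext t
    apply hW
    have h1 := intervalIntegral.integral_eq_sub_of_hasDerivAt (a := 0) (b := t)
      (fun s _ => h s) ((W.continuous.comp hg).intervalIntegrable _ _)
    rw [map_add, ← ContinuousLinearMap.intervalIntegral_comp_comm W (hg.intervalIntegrable _ _), h1]
    abel
  rw [hu]
  exact (intervalIntegral.integral_hasDerivAt_right (hg.intervalIntegrable _ _)
    hg.aestronglyMeasurable.stronglyMeasurableAtFilter hg.continuousAt).const_add _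

end AbstractEvolution

/-! ### The linearized operator on weighted Fourier coefficients and its energy bound. -/

section SequenceSpace

/-- The space `ℓ²(ℤ, ℂ)`. -/
abbrev Seq : Type := lp (fun _ : ℤ => ℂ) 2

theorem memℓp_two_iff {f : ℤ → ℂ} : Memℓp f 2 ↔ Summable fun k => ‖f k‖ ^ 2 := by
  rw [memℓp_gen_iff (by norm_num)]
  norm_num

theorem Seq.summable_sq (y : Seq) : Summable fun k => ‖y k‖ ^ 2 := memℓp_two_iff.1 y.2

theorem Seq.norm_sq (y : Seq) : ‖y‖ ^ 2 = ∑' k, ‖y k‖ ^ 2 := by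
  have := lp.norm_rpow_eq_tsum (p := 2) (by norm_num) y
  norm_num at this
  exact this

theorem Seq.add_apply (y z : Seq) (k : ℤ) : (y + z) k = y k + z k := rfl
theorem Seq.sub_apply (y z : Seq) (k : ℤ) : (y - z) k = y k - z k := rfl
theorem Seq.neg_apply (y : Seq) (k : ℤ) : (-y) k = -y k := rfl
theorem Seq.smul_apply (a : ℂ) (y : Seq) (k : ℤ) : (a • y) k = a * y k := rfl

theorem memℓp_mul_shift {c : ℤ → ℝ} (hc : ∃ C, ∀ k, |c k| ≤ C) (n : ℤ) (y : Seq) :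
    Memℓp (fun k => (c k : ℂ) * y (k + n)) 2 := by
  obtain ⟨C, hC⟩ := hc
  rw [memℓp_two_iff]
  have h := ((Equiv.addRight n).summable_iff.2 y.summable_sq).mul_left (C ^ 2)
  refine h.of_nonneg_of_le (fun k => by positivity) fun k => ?_
  simp only [norm_mul, Complex.norm_real, mul_pow, Function.comp_apply, Equiv.coe_addRight,
    Real.norm_eq_abs]
  gcongr
  exact hC k

theorem norm_mul_shift_le {c : ℤ → ℝ} {C : ℝ} (hC : ∀ k, |c k| ≤ C) (n : ℤ) (y : Seq) :
    ‖(⟨fun k => (c k : ℂ) * y (k + n), memℓp_mul_shift ⟨C, hC⟩ n y⟩ : Seq)‖ ≤ C * ‖y‖ := by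
  have hC0 : 0 ≤ C := (abs_nonneg _).trans (hC 0)
  refine le_of_sq_le_sq ?_ (by positivity)
  have hs := (Equiv.addRight n).tsum_eq fun k => ‖y k‖ ^ 2
  rw [mul_pow, Seq.norm_sq, Seq.norm_sq, ← hs, ← tsum_mul_left]
  refine (memℓp_two_iff.1 (memℓp_mul_shift ⟨C, hC⟩ n y)).tsum_le_tsum (fun k => ?_)
    (((Equiv.addRight n).summable_iff.2 y.summable_sq).mul_left (C ^ 2))
  simp only [norm_mul, Complex.norm_real, mul_pow, Equiv.coe_addRight, Real.norm_eq_abs]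
  gcongr
  exact hC k

/-- The weighted shift `(y_k) ↦ (c_k y_{k+n})` on `ℓ²(ℤ, ℂ)`. -/
def wshift (c : ℤ → ℝ) (n : ℤ) (hc : ∃ C, ∀ k, |c k| ≤ C) : Seq →L[ℂ] Seq :=
  LinearMap.mkContinuous
    { toFun := fun y => ⟨fun k => (c k : ℂ) * y (k + n), memℓp_mul_shift hc n y⟩
      map_add' := fun y z => by ext k; exact mul_add _ _ _
      map_smul' := fun a y => by ext k; exact mul_left_comm _ _ _ }
    hc.choose (norm_mul_shift_le hc.choose_spec n)

@[simp] theorem wshift_apply (c : ℤ → ℝ) (n : ℤ) (hc : ∃ C, ∀ k, |c k| ≤ C) (y : Seq) (k : ℤ) :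
    wshift c n hc y k = (c k : ℂ) * y (k + n) := rfl

theorem norm_wshift_le {c : ℤ → ℝ} {C : ℝ} (hC : ∀ k, |c k| ≤ C) (n : ℤ)
    (hc : ∃ C, ∀ k, |c k| ≤ C) : ‖wshift c n hc‖ ≤ C :=
  ContinuousLinearMap.opNorm_le_bound _ ((abs_nonneg _).trans (hC 0)) (norm_mul_shift_le hC n)

theorem inner_wshift_left {c c' : ℤ → ℝ} {n : ℤ} (hc : ∃ C, ∀ k, |c k| ≤ C)
    (hc' : ∃ C, ∀ k, |c' k| ≤ C) (h : ∀ k, c' (k + n) = c k) (y z : Seq) :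
    inner ℂ (wshift c n hc y) z = inner ℂ y (wshift c' (-n) hc' z) := by
  rw [lp.inner_eq_tsum, lp.inner_eq_tsum, ← (Equiv.addRight n).tsum_eq (fun k =>
    inner ℂ (y k) (wshift c' (-n) hc' z k))]
  refine tsum_congr fun k => ?_
  simp [h]
  ring

theorem abs_re_inner_le (A : Seq →L[ℂ] Seq) {C : ℝ} (hA : ‖A‖ ≤ C) (y : Seq) :
    |RCLike.re (inner ℂ y (A y))| ≤ C * ‖y‖ ^ 2 := by
  calc |RCLike.re (inner ℂ y (A y))| ≤ ‖inner ℂ y (A y)‖ := RCLike.abs_re_le_norm _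
    _ ≤ ‖y‖ * ‖A y‖ := norm_inner_le_norm _ _
    _ ≤ ‖y‖ * (C * ‖y‖) := by
        gcongr; exact (A.le_opNorm y).trans (by gcongr)
    _ = _ := by ring

/-- The weight `1 + |k|`. -/
def rho (k : ℤ) : ℝ := 1 + |(k : ℝ)|

theorem one_le_rho (k : ℤ) : 1 ≤ rho k := by simp [rho]
theorem rho_pos (k : ℤ) : 0 < rho k := one_pos.trans_le (one_le_rho k)
theorem rho_ne_zero (k : ℤ) : rho k ≠ 0 := (rho_pos k).ne'
theorem abs_le_rho (k : ℤ) : |(k : ℝ)| ≤ rho k := by simp [rho]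

theorem abs_rho_sub_le (j k : ℤ) (h : |j - k| ≤ 2) : |rho j - rho k| ≤ 2 := by
  have h1 : |(j : ℝ) - k| ≤ 2 := by exact_mod_cast h
  have := abs_abs_sub_abs_le (j : ℝ) k
  simp only [rho, add_sub_add_left_eq_sub]
  linarith

theorem rho_le_three_mul (j k : ℤ) (h : |j - k| ≤ 2) : rho j ≤ 3 * rho k := by
  have := (abs_le.1 (abs_rho_sub_le j k h)).2
  linarith [one_le_rho k]

theorem rho_div_le (j k : ℤ) (h : |j - k| ≤ 2) : rho j / rho k ≤ 3 := by
  rw [div_le_iff₀ (rho_pos k)]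
  exact rho_le_three_mul j k h

theorem rho_div_nonneg (j k : ℤ) : 0 ≤ rho j / rho k := (div_pos (rho_pos j) (rho_pos k)).le

theorem rho_div_pow_le (j k : ℤ) (h : |j - k| ≤ 2) (s : ℕ) : (rho j / rho k) ^ s ≤ 3 ^ s :=
  pow_le_pow_left₀ (rho_div_nonneg j k) (rho_div_le j k h) s

theorem abs_pow_sub_one_le {r : ℝ} (h0 : 0 ≤ r) (h3 : r ≤ 3) (s : ℕ) :
    |r ^ s - 1| ≤ s * 3 ^ s * |r - 1| := by
  induction s with
  | zero => simp
  | succ s ih =>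
    have e : r ^ (s + 1) - 1 = r * (r ^ s - 1) + (r - 1) := by ring
    rw [e]
    refine (abs_add_le _ _).trans ?_
    rw [abs_mul, abs_of_nonneg h0]
    have h1 : r * |r ^ s - 1| ≤ 3 * (s * 3 ^ s * |r - 1|) := by gcongr
    have h2 : (1 : ℝ) ≤ 3 ^ (s + 1) := one_le_pow₀ (by norm_num)
    have h3 : |r - 1| ≤ 3 ^ (s + 1) * |r - 1| := le_mul_of_one_le_left (abs_nonneg _) h2
    push_cast
    calc _ ≤ 3 * (s * 3 ^ s * |r - 1|) + 3 ^ (s + 1) * |r - 1| := add_le_add h1 h3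
      _ = _ := by ring

/-- This is the commutator bound for the weights: the ratio of weights two modes apart is `1 +
O(1/rho k)`, which absorbs a multiplier of size `|k|`. -/
theorem abs_rho_div_pow_sub_one_mul_le (j k : ℤ) (h : |j - k| ≤ 2) (s : ℕ) {d : ℝ}
    (hd : |d| ≤ |(k : ℝ)|) : |((rho j / rho k) ^ s - 1) * d| ≤ 2 * (s * 3 ^ s) := by
  have h1 := abs_pow_sub_one_le (rho_div_nonneg j k) (rho_div_le j k h) s
  have h2 : |rho j / rho k - 1| * |d| ≤ 2 := by
    have e : rho j / rho k - 1 = (rho j - rho k) / rho k := by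
      field_simp [rho_ne_zero k]
    rw [e, abs_div, abs_of_pos (rho_pos k), div_mul_eq_mul_div, div_le_iff₀ (rho_pos k)]
    exact mul_le_mul (abs_rho_sub_le j k h) (hd.trans (abs_le_rho k)) (abs_nonneg _) (by norm_num)
  rw [abs_mul]
  calc _ ≤ s * 3 ^ s * |rho j / rho k - 1| * |d| := by gcongr
    _ = s * 3 ^ s * (|rho j / rho k - 1| * |d|) := by ring
    _ ≤ s * 3 ^ s * 2 := by gcongr
    _ = _ := by ring

/-- The bounded part of the coefficient with which mode `k` feeds mode `k + 2`. -/
def lowUp (k : ℤ) : ℝ := -1 / 2 - (SignType.sign k : ℝ) / 2 + 1 / |(k : ℝ)|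

/-- The bounded part of the coefficient with which mode `k` feeds mode `k - 2`. -/
def lowDown (k : ℤ) : ℝ := -1 / 2 + (SignType.sign k : ℝ) / 2 + 1 / |(k : ℝ)|

theorem abs_sign_le (k : ℤ) : |(SignType.sign k : ℝ)| ≤ 1 := by
  rcases SignType.sign k with _ | _ | _ <;> simp

theorem one_div_abs_le (k : ℤ) : 1 / |(k : ℝ)| ≤ 1 := by
  rcases eq_or_ne k 0 with rfl | hk
  · simp
  · rw [div_le_one (by positivity)]
    exact_mod_cast Int.one_le_abs hk

theorem abs_lowUp_le (k : ℤ) : |lowUp k| ≤ 2 := by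
  have h1 := abs_le.1 (abs_sign_le k)
  have h2 := one_div_abs_le k
  have h3 : 0 ≤ 1 / |(k : ℝ)| := by positivity
  rw [lowUp, abs_le]
  constructor <;> linarith [h1.1, h1.2]

theorem abs_lowDown_le (k : ℤ) : |lowDown k| ≤ 2 := by
  have h1 := abs_le.1 (abs_sign_le k)
  have h2 := one_div_abs_le k
  have h3 : 0 ≤ 1 / |(k : ℝ)| := by positivity
  rw [lowDown, abs_le]
  constructor <;> linarith [h1.1, h1.2]

/-- Coefficient of `y_{j-2}` in the `j`-th mode of the operator conjugated to level `s`, where the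
multiplier `d` stands for the wave number. -/
def upCoeff (d : ℤ → ℝ) (s : ℕ) (j : ℤ) : ℝ :=
  (rho j / rho (j - 2)) ^ s * (d (j - 2) / 4 + lowUp (j - 2))

/-- Coefficient of `y_{j+2}`. -/
def downCoeff (d : ℤ → ℝ) (s : ℕ) (j : ℤ) : ℝ :=
  (rho j / rho (j + 2)) ^ s * (-(d (j + 2) / 4) + lowDown (j + 2))

theorem bound_upCoeff {d : ℤ → ℝ} {N : ℝ} (hN : ∀ k, |d k| ≤ N) (s : ℕ) (j : ℤ) :
    |upCoeff d s j| ≤ 3 ^ s * (N / 4 + 2) := by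
  rw [upCoeff, abs_mul, abs_of_nonneg (pow_nonneg (rho_div_nonneg _ _) _)]
  refine mul_le_mul (rho_div_pow_le _ _ (by simp) s) ?_ (abs_nonneg _) (by positivity)
  refine (abs_add_le _ _).trans (add_le_add ?_ (abs_lowUp_le _))
  rw [abs_div, abs_of_pos (by norm_num : (0 : ℝ) < 4)]
  gcongr
  exact hN _

theorem bound_downCoeff {d : ℤ → ℝ} {N : ℝ} (hN : ∀ k, |d k| ≤ N) (s : ℕ) (j : ℤ) :
    |downCoeff d s j| ≤ 3 ^ s * (N / 4 + 2) := by
  rw [downCoeff, abs_mul, abs_of_nonneg (pow_nonneg (rho_div_nonneg _ _) _)]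
  refine mul_le_mul (rho_div_pow_le _ _ (by simp) s) ?_ (abs_nonneg _) (by positivity)
  refine (abs_add_le _ _).trans (add_le_add ?_ (abs_lowDown_le _))
  rw [abs_neg, abs_div, abs_of_pos (by norm_num : (0 : ℝ) < 4)]
  gcongr
  exact hN _

theorem summable_one_div_sq_int : Summable fun k : ℤ => (1 / |(k : ℝ)|) ^ 2 := by
  have := Real.summable_one_div_int_pow.2 (by norm_num : 1 < 2)
  refine this.congr fun k => ?_
  rw [div_pow, sq_abs, one_pow]

theorem memℓp_gaugeSeq (s : ℕ) : Memℓp (fun k : ℤ => ((1 / |(k : ℝ)| / rho k ^ s : ℝ) : ℂ)) 2 := by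
  rw [memℓp_two_iff]
  refine summable_one_div_sq_int.of_nonneg_of_le (fun k => by positivity) fun k => ?_
  rw [Complex.norm_real, Real.norm_eq_abs, abs_of_nonneg
    (div_nonneg (by positivity) (pow_nonneg (rho_pos k).le s))]
  have h0 := div_nonneg (by positivity : 0 ≤ 1 / |(k : ℝ)|) (pow_nonneg (rho_pos k).le s)
  exact pow_le_pow_left₀ h0 (div_le_self (by positivity) (one_le_pow₀ (one_le_rho k))) 2

/-- The sequence `1 / (|k| (1 + |k|)^s)`. -/
def gaugeSeq (s : ℕ) : Seq := ⟨_, memℓp_gaugeSeq s⟩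

theorem gaugeSeq_apply (s : ℕ) (k : ℤ) :
    gaugeSeq s k = ((1 / |(k : ℝ)| / rho k ^ s : ℝ) : ℂ) := rfl

/-- The sequence of the Fourier coefficients of `2 cos 2θ`. -/
def cosSeq : Seq := lp.single 2 2 1 + lp.single 2 (-2) 1

/-- The rank-one operator due to the gauge condition, at level `s`. -/
def gaugeOp (s : ℕ) : Seq →L[ℂ] Seq :=
  ((3 : ℂ) ^ s) • (innerSL ℂ (gaugeSeq s)).smulRight cosSeq

theorem gaugeOp_apply (s : ℕ) (y : Seq) (j : ℤ) :
    gaugeOp s y j = 3 ^ s * (inner ℂ (gaugeSeq s) y * cosSeq j) := by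
  simp [gaugeOp]

/-- The operator of the linearized equation at level `s`, with the multiplier `d` in place of the
wave number. -/
def gen (d : ℤ → ℝ) (hd : ∃ N, ∀ k, |d k| ≤ N) (s : ℕ) : Seq →L[ℂ] Seq :=
  wshift (upCoeff d s) (-2) ⟨_, bound_upCoeff hd.choose_spec s⟩
    + wshift (downCoeff d s) 2 ⟨_, bound_downCoeff hd.choose_spec s⟩ - gaugeOp s

theorem gen_apply (d : ℤ → ℝ) (hd : ∃ N, ∀ k, |d k| ≤ N) (s : ℕ) (y : Seq) (j : ℤ) :
    gen d hd s y j = upCoeff d s j * y (j - 2) + downCoeff d s j * y (j + 2) - gaugeOp s y j := by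
  rfl

/-- The constant is independent of the truncation `d`. The leading part is the shift up with weights
`d/4` minus the shift down, and the second is the adjoint of the first up to the increments of `d`,
so only bounded operators contribute to the real part. -/
theorem energy_gen (s : ℕ) : ∃ C, 0 ≤ C ∧ ∀ (d : ℤ → ℝ) (hd : ∃ N, ∀ k, |d k| ≤ N),
    (∀ k : ℤ, |d k| ≤ |(k : ℝ)|) → (∀ k, |d (k + 2) - d k| ≤ 2) →
    ∀ y, |RCLike.re (inner ℂ y (-gen d hd s y))| ≤ C * ‖y‖ ^ 2 := by
  set K : ℝ := 2 * (s * 3 ^ s) / 4 + 3 ^ s * 2 with hK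
  have hK0 : 0 ≤ K := by positivity
  -- The `1/2` bounds the failure of skewness of the leading part; each `K` bounds the commutator
  -- and lower-order terms of one shift.
  refine ⟨1 / 2 + K + K + ‖gaugeOp s‖, by positivity, fun d hd h1 h2 y => ?_⟩
  have b0 : ∃ C, ∀ k, |(fun j => d (j - 2) / 4) k| ≤ C := by
    obtain ⟨N, hN⟩ := hd
    exact ⟨N / 4, fun k => by
      simp only [abs_div, abs_of_pos (by norm_num : (0 : ℝ) < 4)]; gcongr; exact hN _⟩
  have b1 : ∃ C, ∀ k, |(fun j => d (j + 2) / 4) k| ≤ C := by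
    obtain ⟨N, hN⟩ := hd
    exact ⟨N / 4, fun k => by
      simp only [abs_div, abs_of_pos (by norm_num : (0 : ℝ) < 4)]; gcongr; exact hN _⟩
  have b2 : ∃ C, ∀ k, |(fun j => d j / 4) k| ≤ C := by
    obtain ⟨N, hN⟩ := hd
    exact ⟨N / 4, fun k => by
      simp only [abs_div, abs_of_pos (by norm_num : (0 : ℝ) < 4)]; gcongr; exact hN _⟩
  have c0 (j : ℤ) : |(fun j => d (j - 2) / 4 - d j / 4) j| ≤ 1 / 2 := by
    have := h2 (j - 2)
    rw [sub_add_cancel, abs_sub_comm] at this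
    simp only
    rw [← sub_div, abs_div, abs_of_pos (by norm_num : (0 : ℝ) < 4)]
    linarith
  have c1 (j : ℤ) : |(fun j => upCoeff d s j - d (j - 2) / 4) j| ≤ K := by
    have e : upCoeff d s j - d (j - 2) / 4 = ((rho j / rho (j - 2)) ^ s - 1) * d (j - 2) / 4
      + (rho j / rho (j - 2)) ^ s * lowUp (j - 2) := by rw [upCoeff]; ring
    simp only
    rw [e]
    refine (abs_add_le _ _).trans (add_le_add ?_ ?_)
    · rw [abs_div, abs_of_pos (by norm_num : (0 : ℝ) < 4)]
      gcongr
      exact abs_rho_div_pow_sub_one_mul_le _ _ (by simp) s (h1 _)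
    · rw [abs_mul, abs_of_nonneg (pow_nonneg (rho_div_nonneg _ _) _)]
      exact mul_le_mul (rho_div_pow_le _ _ (by simp) s) (abs_lowUp_le _) (abs_nonneg _)
        (by positivity)
  have c2 (j : ℤ) : |(fun j => downCoeff d s j + d (j + 2) / 4) j| ≤ K := by
    have e : downCoeff d s j + d (j + 2) / 4 = -(((rho j / rho (j + 2)) ^ s - 1) * d (j + 2)) / 4
      + (rho j / rho (j + 2)) ^ s * lowDown (j + 2) := by rw [downCoeff]; ring
    simp only
    rw [e]
    refine (abs_add_le _ _).trans (add_le_add ?_ ?_)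
    · rw [abs_div, abs_neg, abs_of_pos (by norm_num : (0 : ℝ) < 4)]
      gcongr
      exact abs_rho_div_pow_sub_one_mul_le _ _ (by simp) s (h1 _)
    · rw [abs_mul, abs_of_nonneg (pow_nonneg (rho_div_nonneg _ _) _)]
      exact mul_le_mul (rho_div_pow_le _ _ (by simp) s) (abs_lowDown_le _) (abs_nonneg _)
        (by positivity)
  set D := wshift _ (-2) ⟨_, c0⟩ with hD
  set U := wshift _ (-2) ⟨_, c1⟩ with hU
  set V := wshift _ 2 ⟨_, c2⟩ with hV
  have e1 : gen d hd s = (wshift _ (-2) b0 - wshift _ 2 b1) + U + V - gaugeOp s := by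
    ext y j
    simp only [gen_apply, hU, hV, sub_apply, add_apply, Seq.sub_apply, Seq.add_apply, wshift_apply,
      ← sub_eq_add_neg]
    push_cast
    ring
  -- Inside the real part the downward shift may be replaced by its adjoint, an upward shift. The
  -- two leading terms then combine into `D`, whose weights are the increments `(d (j - 2) - d j) /
  -- 4`.
  have e2 : RCLike.re (inner ℂ y (wshift _ (-2) b0 y - wshift _ 2 b1 y))
      = RCLike.re (inner ℂ y (D y)) := by
    rw [inner_sub_right, map_sub, ← inner_conj_symm y (wshift _ 2 b1 y), RCLike.conj_re,
      inner_wshift_left b1 b2 (fun k => rfl), ← map_sub, ← inner_sub_right]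
    congr 2
    ext j
    simp only [hD, Seq.sub_apply, wshift_apply]
    push_cast
    ring
  have i0 := abs_le.1 (abs_re_inner_le D (norm_wshift_le c0 _ _) y)
  have i1 := abs_le.1 (abs_re_inner_le U (norm_wshift_le c1 _ _) y)
  have i2 := abs_le.1 (abs_re_inner_le V (norm_wshift_le c2 _ _) y)
  have i3 := abs_le.1 (abs_re_inner_le (gaugeOp s) le_rfl y)
  have e3 : RCLike.re (inner ℂ y (-gen d hd s y)) = -(RCLike.re (inner ℂ y (D y))
      + RCLike.re (inner ℂ y (U y)) + RCLike.re (inner ℂ y (V y))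
      - RCLike.re (inner ℂ y (gaugeOp s y))) := by
    rw [← e2, e1]
    simp only [sub_apply, add_apply, inner_neg_right, inner_sub_right, inner_add_right, map_sub,
      map_add, map_neg]
  rw [e3, abs_le]
  constructor <;> linarith [i0.1, i0.2, i1.1, i1.2, i2.1, i2.2, i3.1, i3.2]

end SequenceSpace

/-! ### The scale of levels, convergence of the truncated generators, and the Fourier evolution. -/

section SequenceEvolution

theorem abs_inv_rho_pow_le (r : ℕ) (k : ℤ) : |(rho k ^ r)⁻¹| ≤ 1 := by
  rw [abs_of_nonneg (inv_nonneg.2 (pow_nonneg (rho_pos k).le r))]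
  exact inv_le_one_of_one_le₀ (one_le_pow₀ (one_le_rho k))

/-- The smoothing operator `(y_k) ↦ ((1 + |k|)^{-r} y_k)`. -/
def wt (r : ℕ) : Seq →L[ℂ] Seq := wshift (fun k => (rho k ^ r)⁻¹) 0 ⟨1, abs_inv_rho_pow_le r⟩

theorem wt_apply (r : ℕ) (y : Seq) (k : ℤ) : wt r y k = ((rho k : ℂ) ^ r)⁻¹ * y k := by
  simp [wt]

theorem ofReal_rho_ne_zero (k : ℤ) : (rho k : ℂ) ≠ 0 := by exact_mod_cast rho_ne_zero k

theorem wt_add_apply (r s : ℕ) (y : Seq) : wt r (wt s y) = wt (r + s) y := by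
  ext k
  rw [wt_apply, wt_apply, wt_apply, pow_add, mul_inv]
  ring

theorem wt_zero_apply (y : Seq) : wt 0 y = y := by
  ext k
  simp [wt_apply]

theorem wt_injective (r : ℕ) : Function.Injective (wt r) := by
  intro y z h
  ext k
  have := congrArg (fun x : Seq => x k) h
  simp only [wt_apply] at this
  exact mul_left_cancel₀ (inv_ne_zero (pow_ne_zero _ (ofReal_rho_ne_zero k))) this

theorem wt_denseRange (r : ℕ) : DenseRange (wt r) := by
  intro y
  refine mem_closure_of_tendsto (lp.hasSum_single (by norm_num) y)
    (Eventually.of_forall fun t => ?_)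
  change _ ∈ ((wt r).range : Set Seq)
  refine Submodule.sum_mem _ fun k _ => ⟨(rho k : ℂ) ^ r • lp.single 2 k (y k), ?_⟩
  ext j
  rw [ContinuousLinearMap.coe_coe, map_smul, Seq.smul_apply, wt_apply]
  rcases eq_or_ne j k with rfl | h
  · rw [lp.single_apply_self, mul_inv_cancel_left₀ (pow_ne_zero _ (ofReal_rho_ne_zero j))]
  · rw [lp.single_apply_ne _ _ _ h]
    simp

theorem cosSeq_apply (j : ℤ) : cosSeq j = if j = 2 ∨ j = -2 then 1 else 0 := by
  rw [cosSeq, Seq.add_apply, lp.single_apply, lp.single_apply]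
  by_cases h : j = 2
  · subst h; simp
  · by_cases h' : j = -2
    · subst h'; simp
    · simp [h, h']

/-- Both modes `±2` have weight 3, so conjugation by the weights multiplies this vector by a scalar.
This is the origin of the factor `3 ^ s` in `gaugeOp`. -/
theorem rho_pow_mul_cosSeq (r : ℕ) (j : ℤ) : (rho j : ℂ) ^ r * cosSeq j = 3 ^ r * cosSeq j := by
  rw [cosSeq_apply]
  split_ifs with h
  · have : rho j = 3 := by rcases h with rfl | rfl <;> norm_num [rho]
    rw [this]
    norm_num
  · simp

theorem inner_gaugeSeq (s : ℕ) (y : Seq) :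
    inner ℂ (gaugeSeq s) y = ∑' k : ℤ, (1 / |(k : ℝ)| : ℝ) * ((wt s y) k) := by
  rw [lp.inner_eq_tsum]
  refine tsum_congr fun k => ?_
  rw [gaugeSeq_apply, wt_apply]
  simp only [RCLike.inner_apply, Complex.conj_ofReal]
  push_cast
  ring

theorem gaugeOp_wt (s r : ℕ) (y : Seq) : gaugeOp s (wt r y) = wt r (gaugeOp (s + r) y) := by
  ext j
  rw [wt_apply, gaugeOp_apply, gaugeOp_apply, inner_gaugeSeq, inner_gaugeSeq, wt_add_apply]
  have h := rho_pow_mul_cosSeq r j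
  rw [eq_inv_mul_iff_mul_eq₀ (pow_ne_zero _ (ofReal_rho_ne_zero j))]
  linear_combination (3 ^ s * ∑' k : ℤ, (1 / |(k : ℝ)| : ℝ) * ((wt (s + r) y) k)) * h

theorem upCoeff_mul (d : ℤ → ℝ) (s r : ℕ) (j : ℤ) :
    upCoeff d s j * (rho (j - 2) ^ r)⁻¹ = (rho j ^ r)⁻¹ * upCoeff d (s + r) j := by
  have h1 := rho_ne_zero j
  have h2 := rho_ne_zero (j - 2)
  rw [upCoeff, upCoeff, pow_add, div_pow _ _ r]
  field_simp

theorem downCoeff_mul (d : ℤ → ℝ) (s r : ℕ) (j : ℤ) :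
    downCoeff d s j * (rho (j + 2) ^ r)⁻¹ = (rho j ^ r)⁻¹ * downCoeff d (s + r) j := by
  have h1 := rho_ne_zero j
  have h2 := rho_ne_zero (j + 2)
  rw [downCoeff, downCoeff, pow_add, div_pow _ _ r]
  field_simp

/-- The operators at all levels are conjugates, by powers of `rho`, of a single operator on the
coefficients. -/
theorem gen_wt (d : ℤ → ℝ) (hd : ∃ N, ∀ k, |d k| ≤ N) (s r : ℕ) (y : Seq) :
    gen d hd s (wt r y) = wt r (gen d hd (s + r) y) := by
  ext j
  have h1 := congrArg (fun x : ℝ => (x : ℂ)) (upCoeff_mul d s r j)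
  have h2 := congrArg (fun x : ℝ => (x : ℂ)) (downCoeff_mul d s r j)
  have h3 := congrArg (fun x : Seq => x j) (gaugeOp_wt s r y)
  push_cast at h1 h2
  simp only [wt_apply] at h3
  rw [wt_apply, gen_apply, gen_apply, wt_apply, wt_apply, h3]
  linear_combination y (j - 2) * h1 + y (j + 2) * h2

theorem bound_upCoeff_div (s : ℕ) (j : ℤ) :
    |upCoeff (fun k => (k : ℝ)) s j / rho j| ≤ 3 ^ s * 3 := by
  have h1 := rho_le_three_mul (j - 2) j (by simp)
  rw [abs_div, abs_of_pos (rho_pos j), div_le_iff₀ (rho_pos j), upCoeff, abs_mul,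
    abs_of_nonneg (pow_nonneg (rho_div_nonneg _ _) _), mul_assoc]
  refine mul_le_mul (rho_div_pow_le _ _ (by simp) s) ?_ (abs_nonneg _) (by positivity)
  refine (abs_add_le _ _).trans ?_
  rw [abs_div, abs_of_pos (by norm_num : (0 : ℝ) < 4)]
  linarith [abs_lowUp_le (j - 2), abs_le_rho (j - 2), one_le_rho j]

theorem bound_downCoeff_div (s : ℕ) (j : ℤ) :
    |downCoeff (fun k => (k : ℝ)) s j / rho j| ≤ 3 ^ s * 3 := by
  have h1 := rho_le_three_mul (j + 2) j (by simp)
  rw [abs_div, abs_of_pos (rho_pos j), div_le_iff₀ (rho_pos j), downCoeff, abs_mul,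
    abs_of_nonneg (pow_nonneg (rho_div_nonneg _ _) _), mul_assoc]
  refine mul_le_mul (rho_div_pow_le _ _ (by simp) s) ?_ (abs_nonneg _) (by positivity)
  refine (abs_add_le _ _).trans ?_
  rw [abs_neg, abs_div, abs_of_pos (by norm_num : (0 : ℝ) < 4)]
  linarith [abs_lowDown_le (j + 2), abs_le_rho (j + 2), one_le_rho j]

/-- The operator of the linearized equation as a bounded operator losing one derivative: from
level `s + 1` to level `s`, at level `s + 1` of the argument. -/
def smoothGen (s : ℕ) : Seq →L[ℂ] Seq :=
  wshift (fun j => upCoeff (fun k => (k : ℝ)) s j / rho j) (-2) ⟨_, bound_upCoeff_div s⟩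
    + wshift (fun j => downCoeff (fun k => (k : ℝ)) s j / rho j) 2 ⟨_, bound_downCoeff_div s⟩
    - wt 1 * gaugeOp s

theorem smoothGen_apply (s : ℕ) (y : Seq) (j : ℤ) :
    smoothGen s y j = (rho j : ℂ)⁻¹ * (upCoeff (fun k => (k : ℝ)) s j * y (j - 2)
      + downCoeff (fun k => (k : ℝ)) s j * y (j + 2) - gaugeOp s y j) := by
  have h : smoothGen s y j = (upCoeff (fun k => (k : ℝ)) s j / rho j : ℝ) * y (j - 2)
    + (downCoeff (fun k => (k : ℝ)) s j / rho j : ℝ) * y (j + 2) - wt 1 (gaugeOp s y) j := rfl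
  rw [h, wt_apply, pow_one]
  push_cast
  ring

theorem smoothGen_wt (s : ℕ) (y : Seq) : smoothGen s (wt 1 y) = wt 1 (smoothGen (s + 1) y) := by
  ext j
  have h1 := congrArg (fun x : ℝ => (x : ℂ)) (upCoeff_mul (fun k => (k : ℝ)) s 1 j)
  have h2 := congrArg (fun x : ℝ => (x : ℂ)) (downCoeff_mul (fun k => (k : ℝ)) s 1 j)
  have h3 := congrArg (fun x : Seq => x j) (gaugeOp_wt s 1 y)
  push_cast at h1 h2
  simp only [wt_apply] at h3
  rw [wt_apply, smoothGen_apply, smoothGen_apply, wt_apply, wt_apply, h3]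
  linear_combination (rho j : ℂ)⁻¹ * (y (j - 2) * h1 + y (j + 2) * h2)

/-- The wave number `k` truncated to `[-N, N]`. -/
def clampMode (N : ℕ) (k : ℤ) : ℝ := max (-N) (min k N)

theorem abs_clampMode_le (N : ℕ) (k : ℤ) : |clampMode N k| ≤ N := by
  rw [clampMode, abs_le]
  exact ⟨le_max_left _ _, max_le (by linarith [Nat.cast_nonneg (α := ℝ) N]) (min_le_right _ _)⟩

theorem abs_clampMode_le_abs (N : ℕ) (k : ℤ) : |clampMode N k| ≤ |(k : ℝ)| := by
  have hN := Nat.cast_nonneg (α := ℝ) N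
  rw [clampMode]
  rcases max_cases (-(N : ℝ)) (min k N) with h | h <;> rcases min_cases (k : ℝ) N with h' | h' <;>
    rw [h.1] <;> simp only [h'.1] at * <;> rw [abs_le] <;>
    constructor <;> linarith [neg_abs_le (k : ℝ), le_abs_self (k : ℝ), h.2, h'.2]

/-- Clamping is 1-Lipschitz. Setting the multiplier to zero beyond `N` would create a jump of size
about `N` and ruin the uniform energy bound. -/
theorem abs_clampMode_sub_le (N : ℕ) (k : ℤ) : |clampMode N (k + 2) - clampMode N k| ≤ 2 := by
  have h1 := abs_max_sub_max_le_abs (min ((k + 2 : ℤ) : ℝ) N) (min (k : ℝ) N) (-(N : ℝ))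
  have h2 := abs_min_sub_min_le_max ((k + 2 : ℤ) : ℝ) N (k : ℝ) N
  rw [clampMode, clampMode, max_comm, max_comm (-(N : ℝ))]
  refine h1.trans (h2.trans ?_)
  push_cast
  simp

/-- The error vanishes for `|k| ≤ N` and is at most `|k|` beyond, where also `N < |k|`: one extra
weight is exchanged for a factor `1/N`. -/
theorem abs_clampMode_sub_self_mul_le (N : ℕ) (k : ℤ) :
    |clampMode N k - k| * N ≤ rho k ^ 2 := by
  have hN := Nat.cast_nonneg (α := ℝ) N
  by_cases h : |(k : ℝ)| ≤ N
  · have := abs_le.1 h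
    rw [clampMode, min_eq_left this.2, max_eq_right this.1]
    simp only [sub_self, abs_zero, zero_mul]
    positivity
  · push Not at h
    have h1 : |clampMode N k - k| ≤ |(k : ℝ)| := by
      rcases lt_abs.1 h with h' | h'
      · rw [clampMode, min_eq_right h'.le, max_eq_right (by linarith), abs_sub_comm,
          abs_of_pos (by linarith)]
        linarith [le_abs_self (k : ℝ)]
      · rw [clampMode, min_eq_left (by linarith), max_eq_left (by linarith),
          abs_of_pos (by linarith)]
        linarith [neg_abs_le (k : ℝ), le_abs_self (k : ℝ), neg_le_abs (k : ℝ)]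
    have h2 := abs_le_rho k
    nlinarith [abs_nonneg (clampMode N k - k), abs_nonneg (k : ℝ)]

/-- One weight compensates the first-order operator and the second supplies the rate `1/N`. The
bounded terms and the gauge term are not truncated and cancel exactly. -/
theorem norm_wt_mul_gen_sub_le (s N : ℕ) (hN : 0 < N) :
    ‖wt 2 * gen (clampMode N) ⟨N, abs_clampMode_le N⟩ s - wt 1 * smoothGen s‖
      ≤ 2 * (3 ^ s * 9 / N) := by
  have hN' : (0 : ℝ) < N := by exact_mod_cast hN
  have key (j i : ℤ) (h : |j - i| ≤ 2) (h' : |i - j| ≤ 2) :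
      |(rho j ^ 2)⁻¹ * ((rho j / rho i) ^ s * ((clampMode N i - i) / 4))| ≤ 3 ^ s * 9 / N := by
    have h1 := abs_clampMode_sub_self_mul_le N i
    have h2 := rho_le_three_mul i j h'
    have h3 := rho_pos i
    have h4 := rho_pos j
    rw [abs_mul, abs_of_nonneg (by positivity), abs_mul,
      abs_of_nonneg (pow_nonneg (rho_div_nonneg _ _) _), abs_div,
      abs_of_pos (by norm_num : (0 : ℝ) < 4), inv_mul_le_iff₀ (by positivity)]
    have h5 : |clampMode N i - i| / 4 ≤ rho j ^ 2 * 9 / N := by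
      rw [le_div_iff₀ hN']
      have : rho i ^ 2 ≤ (3 * rho j) ^ 2 := by gcongr
      nlinarith [mul_nonneg (abs_nonneg (clampMode N i - i)) hN'.le]
    calc _ ≤ 3 ^ s * (rho j ^ 2 * 9 / N) :=
          mul_le_mul (rho_div_pow_le _ _ h s) h5 (by positivity) (by positivity)
      _ = _ := by ring
  have k1 (j : ℤ) : |(fun j => (rho j ^ 2)⁻¹ * ((rho j / rho (j - 2)) ^ s
      * ((clampMode N (j - 2) - (j - 2 : ℤ)) / 4))) j| ≤ 3 ^ s * 9 / N := key _ _ (by simp) (by simp)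
  have k2 (j : ℤ) : |(fun j => -((rho j ^ 2)⁻¹ * ((rho j / rho (j + 2)) ^ s
      * ((clampMode N (j + 2) - (j + 2 : ℤ)) / 4)))) j| ≤ 3 ^ s * 9 / N := by
    simp only [abs_neg]
    exact key _ _ (by simp) (by simp)
  have e : wt 2 * gen (clampMode N) ⟨N, abs_clampMode_le N⟩ s - wt 1 * smoothGen s
      = wshift _ (-2) ⟨_, k1⟩ + wshift _ 2 ⟨_, k2⟩ := by
    ext y j
    have h1 : (wt 2 * gen (clampMode N) ⟨N, abs_clampMode_le N⟩ s - wt 1 * smoothGen s) y j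
      = wt 2 (gen (clampMode N) ⟨N, abs_clampMode_le N⟩ s y) j - wt 1 (smoothGen s y) j := rfl
    rw [h1, add_apply, Seq.add_apply, wshift_apply, wshift_apply, wt_apply, wt_apply, gen_apply,
      smoothGen_apply, upCoeff, upCoeff, downCoeff, downCoeff, ← sub_eq_add_neg]
    push_cast
    rw [sq, mul_inv]
    ring
  rw [e, two_mul]
  exact (norm_add_le _ _).trans (add_le_add (norm_wshift_le k1 _ _) (norm_wshift_le k2 _ _))

theorem tendsto_wt_mul_gen (s : ℕ) :
    Tendsto (fun N : ℕ => wt 2 * gen (clampMode N) ⟨N, abs_clampMode_le N⟩ s) atTop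
      (𝓝 (wt 1 * smoothGen s)) := by
  rw [tendsto_iff_norm_sub_tendsto_zero]
  have h : Tendsto (fun N : ℕ => 2 * (3 ^ s * 9 / (N : ℝ))) atTop (𝓝 0) := by
    simpa using (tendsto_const_div_atTop_nhds_zero_nat (3 ^ s * 9 : ℝ)).const_mul 2
  refine squeeze_zero' (Eventually.of_forall fun N => norm_nonneg _) ?_ h
  filter_upwards [eventually_gt_atTop 0] with N hN using norm_wt_mul_gen_sub_le s N hN

/-- Existence for the linearized equation in Fourier variables at level `s`. -/
theorem exists_seq_evolution (s : ℕ) (y₀ : Seq) :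
    ∃ y : ℝ → Seq, Continuous y ∧ y 0 = y₀ ∧
      ∀ t, HasDerivAt (fun τ => wt 1 (y τ)) (-smoothGen s (y t)) t := by
  obtain ⟨C, hC0, hC⟩ := energy_gen s
  obtain ⟨C', hC'0, hC'⟩ := energy_gen (s + 2)
  set A : ℕ → ℕ → Seq →L[ℂ] Seq := fun s N => -gen (clampMode N) ⟨N, abs_clampMode_le N⟩ s
    with hA
  have hAW (N : ℕ) (y : Seq) : A s N (wt 2 y) = wt 2 (A (s + 2) N y) := by
    simp only [hA, neg_apply, map_neg, gen_wt]
  have hlim (s : ℕ) : Tendsto (fun N => wt 2 * A s N) atTop (𝓝 (-(wt 1 * smoothGen s))) := by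
    simpa only [hA, mul_neg] using (tendsto_wt_mul_gen s).neg
  obtain ⟨y, hy, hy0, hu⟩ := exists_limit_evolution (A := A s) (A' := A (s + 2)) (W := wt 2)
    (fun N y => hC _ ⟨N, abs_clampMode_le N⟩ (abs_clampMode_le_abs N) (abs_clampMode_sub_le N) y)
    (fun N y => hC' _ ⟨N, abs_clampMode_le N⟩ (abs_clampMode_le_abs N) (abs_clampMode_sub_le N) y)
    hC0 hC'0 hAW (wt_denseRange 2) (by
      have e : (fun N => A s N * wt 2) = fun N => wt 2 * A (s + 2) N := by
        funext N
        ext1 y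
        exact hAW N y
      rw [e]
      exact (hlim (s + 2)).cauchySeq) y₀
  -- The limit argument differentiates only `wt 2 (y t)`. Since `smoothGen s` is bounded, the
  -- derivative is `wt 1` of a continuous curve, and one of the two weights can be removed.
  refine ⟨y, hy, hy0, hasDerivAt_of_injective_comp (W := (wt 1).restrictScalars ℝ)
    (wt_injective 1) ((smoothGen s).continuous.comp hy).neg fun t => ?_⟩
  have h := hasDerivAt_of_limit_evolution hu hy (hlim s) t
  have e (z : Seq) : wt 2 z = wt 1 (wt 1 z) := (wt_add_apply 1 1 z).symm
  simp only [e] at h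
  have e2 : (-(wt 1 * smoothGen s)) (y t) = wt 1 (-smoothGen s (y t)) := by
    simp
  rw [e2] at h
  exact h

theorem contDiff_wt_one {s : ℕ} {y : ℝ → Seq} (hy : Continuous y)
    (h : ∀ t, HasDerivAt (fun τ => wt 1 (y τ)) (-smoothGen s (y t)) t) :
    ContDiff ℝ 1 fun t => wt 1 (y t) := by
  rw [contDiff_one_iff_deriv]
  refine ⟨fun t => (h t).differentiableAt, ?_⟩
  rw [show deriv (fun τ => wt 1 (y τ)) = fun t => -smoothGen s (y t) from
    funext fun t => (h t).deriv]
  exact ((smoothGen s).continuous.comp hy).neg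

/-- After one more weight the generator acts on `wt 1 (y t)`, which is already `C¹`; hence the first
derivative is itself `C¹`. -/
theorem contDiff_wt_two {s : ℕ} {y : ℝ → Seq} (hy : Continuous y)
    (h : ∀ t, HasDerivAt (fun τ => wt 1 (y τ)) (-smoothGen (s + 1) (y t)) t) :
    ContDiff ℝ 2 fun t => wt 2 (y t) := by
  have e (z : Seq) : wt 2 z = wt 1 (wt 1 z) := (wt_add_apply 1 1 z).symm
  have h2 (t : ℝ) : HasDerivAt (fun τ => wt 2 (y τ)) (-smoothGen s (wt 1 (y t))) t := by
    have := ((wt 1).restrictScalars ℝ).hasFDerivAt.comp_hasDerivAt t (h t)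
    rw [smoothGen_wt, ← map_neg]
    simp only [e]
    exact this
  rw [show (2 : WithTop ℕ∞) = 1 + 1 by norm_num, contDiff_succ_iff_deriv]
  refine ⟨fun t => (h2 t).differentiableAt, by simp, ?_⟩
  rw [show deriv (fun τ => wt 2 (y τ)) = fun t => -smoothGen s (wt 1 (y t)) from
    funext fun t => (h2 t).deriv]
  exact (((smoothGen s).restrictScalars ℝ).contDiff.comp (contDiff_wt_one hy h)).neg

end SequenceEvolution

/-! ### The principal value as an absolutely convergent integral. -/

section HilbertIntegral

theorem abs_cot_half_le {s : ℝ} (h0 : 0 < s) (h1 : s ≤ π) : |Real.cot (s / 2)| ≤ π / s := by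
  have hs : s / π ≤ Real.sin (s / 2) := by
    have := Real.mul_le_sin (x := s / 2) (by linarith) (by linarith)
    calc s / π = 2 / π * (s / 2) := by ring
      _ ≤ _ := this
  have hpos : 0 < s / π := by positivity
  rw [Real.cot_eq_cos_div_sin, abs_div, abs_of_pos (hpos.trans_le hs)]
  calc _ ≤ 1 / Real.sin (s / 2) := by
        gcongr
        · exact (hpos.trans_le hs).le
        · exact Real.abs_cos_le_one _
    _ ≤ 1 / (s / π) := by gcongr
    _ = π / s := by field_simp

theorem measurable_cot_half : Measurable fun s : ℝ => Real.cot (s / 2) := by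
  have : (fun s : ℝ => Real.cot (s / 2)) = fun s => Real.cos (s / 2) / Real.sin (s / 2) := by
    funext s
    rw [Real.cot_eq_cos_div_sin]
  rw [this]
  fun_prop

theorem abs_cot_half_mul_le {g : ℝ → ℝ} {M s : ℝ} (hg : |g s| ≤ M * s) (h0 : 0 < s) (h1 : s ≤ π) :
    |Real.cot (s / 2) * g s| ≤ π * M := by
  rw [abs_mul]
  calc _ ≤ π / s * (M * s) := by
        gcongr
        exact abs_cot_half_le h0 h1
    _ = _ := by field_simp

theorem intervalIntegrable_cot_half_mul {g : ℝ → ℝ} (hc : Continuous g) {M : ℝ}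
    (hg : ∀ s, 0 ≤ s → |g s| ≤ M * s) :
    IntervalIntegrable (fun s => Real.cot (s / 2) * g s) volume 0 π := by
  rw [intervalIntegrable_iff_integrableOn_Ioc_of_le pi_pos.le]
  refine Measure.integrableOn_of_bounded (M := π * M) (by simp)
    (measurable_cot_half.mul hc.measurable).aestronglyMeasurable ?_
  filter_upwards [ae_restrict_mem measurableSet_Ioc] with s hs
  exact abs_cot_half_mul_le (hg s hs.1.le) hs.1 hs.2

/-- The Hilbert transform of a Lipschitz function as an absolutely convergent integral. -/
def hilbertInt (w : ℝ → ℝ) (θ : ℝ) : ℝ :=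
  1 / (2 * π) * ∫ s in (0 : ℝ)..π, Real.cot (s / 2) * (w (θ - s) - w (θ + s))

theorem abs_sub_symm_le {w : ℝ → ℝ} {M : ℝ} (hw : ∀ a b, |w a - w b| ≤ M * |a - b|) (θ s : ℝ)
    (hs : 0 ≤ s) : |w (θ - s) - w (θ + s)| ≤ 2 * M * s := by
  have := hw (θ - s) (θ + s)
  rw [show θ - s - (θ + s) = -(2 * s) by ring, abs_neg, abs_of_nonneg (by positivity : 0 ≤ 2 * s)] at this
  linarith

/-- Since the cotangent is odd, folding the two halves about `θ` leaves a difference of values of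
`w`, which for Lipschitz `w` cancels the singularity at `s = 0`. -/
theorem hilbertTrunc_eq {w : ℝ → ℝ} (hc : Continuous w) (θ : ℝ) {ε : ℝ} (h0 : 0 < ε)
    (h1 : ε ≤ π) : hilbertTrunc w θ ε
      = 1 / (2 * π) * ∫ s in ε..π, Real.cot (s / 2) * (w (θ - s) - w (θ + s)) := by
  have hcont : ContinuousOn (fun s : ℝ => Real.cot (s / 2)) (uIcc ε π) := by
    have : (fun s : ℝ => Real.cot (s / 2)) = fun s => Real.cos (s / 2) / Real.sin (s / 2) := by
      funext s
      rw [Real.cot_eq_cos_div_sin]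
    rw [this, uIcc_of_le h1]
    refine ContinuousOn.div (by fun_prop) (by fun_prop) fun s hs => ?_
    exact (Real.sin_pos_of_pos_of_lt_pi (by linarith [hs.1]) (by linarith [hs.2, pi_pos])).ne'
  have e1 : ∫ φ in (θ - π)..(θ - ε), Real.cot ((θ - φ) / 2) * w φ
      = ∫ s in ε..π, Real.cot (s / 2) * w (θ - s) := by
    have := intervalIntegral.integral_comp_sub_left (a := ε) (b := π)
      (fun φ => Real.cot ((θ - φ) / 2) * w φ) θ
    rw [← this]
    simp
  have e2 : ∫ φ in (θ + ε)..(θ + π), Real.cot ((θ - φ) / 2) * w φ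
      = -∫ s in ε..π, Real.cot (s / 2) * w (θ + s) := by
    have := intervalIntegral.integral_comp_add_left (a := ε) (b := π)
      (fun φ => Real.cot ((θ - φ) / 2) * w φ) θ
    rw [← this, ← intervalIntegral.integral_neg]
    congr 1
    funext s
    rw [show (θ - (θ + s)) / 2 = -(s / 2) by ring, Real.cot_eq_cos_div_sin,
      Real.cot_eq_cos_div_sin, Real.cos_neg, Real.sin_neg]
    ring
  have i1 : IntervalIntegrable (fun s => Real.cot (s / 2) * w (θ - s)) volume ε π :=
    (hcont.mul (by fun_prop)).intervalIntegrable
  have i2 : IntervalIntegrable (fun s => Real.cot (s / 2) * w (θ + s)) volume ε π :=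
    (hcont.mul (by fun_prop)).intervalIntegrable
  rw [hilbertTrunc, e1, e2, ← sub_eq_add_neg, ← intervalIntegral.integral_sub i1 i2]
  simp only [mul_sub]

theorem continuous_of_lipschitz {w : ℝ → ℝ} {M : ℝ} (hw : ∀ a b, |w a - w b| ≤ M * |a - b|) :
    Continuous w := by
  refine (LipschitzWith.of_dist_le_mul (K := M.toNNReal) fun a b => ?_).continuous
  rw [Real.dist_eq, Real.dist_eq]
  exact (hw a b).trans (by gcongr; exact Real.le_coe_toNNReal M)

theorem intervalIntegrable_hilbertInt {w : ℝ → ℝ} {M : ℝ} (hw : ∀ a b, |w a - w b| ≤ M * |a - b|)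
    (θ : ℝ) : IntervalIntegrable (fun s => Real.cot (s / 2) * (w (θ - s) - w (θ + s))) volume 0 π := by
  have hc := continuous_of_lipschitz hw
  exact intervalIntegrable_cot_half_mul (g := fun s => w (θ - s) - w (θ + s)) (by fun_prop)
    (abs_sub_symm_le hw θ)

theorem hasHilbertAt_hilbertInt {w : ℝ → ℝ} {M : ℝ} (hw : ∀ a b, |w a - w b| ≤ M * |a - b|)
    (θ : ℝ) : HasHilbertAt w θ (hilbertInt w θ) := by
  have hc := continuous_of_lipschitz hw
  have hi := intervalIntegrable_hilbertInt hw θ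
  set G := fun s => Real.cot (s / 2) * (w (θ - s) - w (θ + s)) with hG
  have hint : IntegrableOn G (uIcc 0 π) := by
    rw [uIcc_of_le pi_pos.le, integrableOn_Icc_iff_integrableOn_Ioc]
    exact hi.1
  have hcont := intervalIntegral.continuousOn_primitive_interval_left hint
  have h0 := hcont 0 left_mem_uIcc
  have h1 : Tendsto (fun ε => ∫ s in ε..π, G s) (𝓝[>] 0) (𝓝 (∫ s in (0 : ℝ)..π, G s)) := by
    refine h0.mono_left ?_
    rw [uIcc_of_le pi_pos.le, nhdsWithin_Icc_eq_nhdsGE pi_pos]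
    exact nhdsWithin_mono _ Ioi_subset_Ici_self
  refine (h1.const_mul (1 / (2 * π))).congr' ?_
  filter_upwards [Ioo_mem_nhdsGT pi_pos] with ε hε
  exact (hilbertTrunc_eq hc θ hε.1 hε.2.le).symm

theorem HasHilbertAt.hilbert_eq {w : ℝ → ℝ} {θ h : ℝ} (H : HasHilbertAt w θ h) :
    hilbert w θ = h := H.limUnder_eq

theorem hilbert_eq_hilbertInt {w : ℝ → ℝ} {M : ℝ} (hw : ∀ a b, |w a - w b| ≤ M * |a - b|)
    (θ : ℝ) : hilbert w θ = hilbertInt w θ := (hasHilbertAt_hilbertInt hw θ).hilbert_eq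

theorem integral_cos_int_mul {n : ℕ} (hn : n ≠ 0) : ∫ s in (0 : ℝ)..π, Real.cos (n * s) = 0 := by
  have hn' : (n : ℝ) ≠ 0 := by exact_mod_cast hn
  rw [intervalIntegral.integral_comp_mul_left (fun s => Real.cos s) hn']
  simp

theorem intervalIntegrable_cot_half_mul_sin (k : ℤ) :
    IntervalIntegrable (fun s => Real.cot (s / 2) * Real.sin (k * s)) volume 0 π :=
  intervalIntegrable_cot_half_mul (M := |(k : ℝ)|) (by fun_prop) fun s hs => by
    refine Real.abs_sin_le_abs.trans ?_
    rw [abs_mul, abs_of_nonneg hs]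

/-- Telescoping: `cot(s/2) (sin((n+1)s) - sin(ns)) = cos((n+1)s) + cos(ns)`, whose integral vanishes
except for `n = 0`, where it equals `π`. -/
theorem integral_cot_half_mul_sin_nat (n : ℕ) :
    ∫ s in (0 : ℝ)..π, Real.cot (s / 2) * Real.sin ((n + 1 : ℕ) * s) = π := by
  have step (n : ℕ) : (∫ s in (0 : ℝ)..π, Real.cot (s / 2) * Real.sin ((n + 1 : ℕ) * s))
      - (∫ s in (0 : ℝ)..π, Real.cot (s / 2) * Real.sin (n * s))
      = ∫ s in (0 : ℝ)..π, (Real.cos ((n + 1 : ℕ) * s) + Real.cos (n * s)) := by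
    have i1 := intervalIntegrable_cot_half_mul_sin (n + 1 : ℕ)
    have i2 := intervalIntegrable_cot_half_mul_sin n
    rw [Int.cast_natCast] at i1 i2
    rw [← intervalIntegral.integral_sub i1 i2]
    refine intervalIntegral.integral_congr_ae (Eventually.of_forall fun s hs => ?_)
    rw [uIoc_of_le pi_pos.le] at hs
    have hsin : Real.sin (s / 2) ≠ 0 :=
      (Real.sin_pos_of_pos_of_lt_pi (by linarith [hs.1]) (by linarith [hs.2, pi_pos])).ne'
    rw [Real.cot_eq_cos_div_sin, ← mul_sub, Real.sin_sub_sin, Real.cos_add_cos]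
    push_cast
    rw [show ((n + 1) * s - n * s) / 2 = s / 2 by ring]
    field_simp
  induction n with
  | zero =>
    have h := step 0
    rw [intervalIntegral.integral_add (Continuous.intervalIntegrable (by fun_prop) _ _)
      (Continuous.intervalIntegrable (by fun_prop) _ _), integral_cos_int_mul (by simp)] at h
    simpa using h
  | succ n ih =>
    have h := step (n + 1)
    rw [intervalIntegral.integral_add (Continuous.intervalIntegrable (by fun_prop) _ _)
      (Continuous.intervalIntegrable (by fun_prop) _ _), integral_cos_int_mul (by simp),
      integral_cos_int_mul (by simp), ih] at h
    linarith

theorem integral_cot_half_mul_sin (k : ℤ) :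
    ∫ s in (0 : ℝ)..π, Real.cot (s / 2) * Real.sin (k * s) = π * (SignType.sign k : ℝ) := by
  rcases lt_trichotomy k 0 with hk | rfl | hk
  · obtain ⟨n, hn⟩ := Int.eq_ofNat_of_zero_le (a := -k - 1) (by lia)
    have hk' : k = -((n + 1 : ℕ) : ℤ) := by push_cast; lia
    rw [sign_neg hk, hk']
    have := integral_cot_half_mul_sin_nat n
    have e : ∀ s : ℝ, Real.cot (s / 2) * Real.sin (((-((n + 1 : ℕ) : ℤ) : ℤ) : ℝ) * s)
        = -(Real.cot (s / 2) * Real.sin (((n + 1 : ℕ) : ℝ) * s)) := by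
      intro s
      push_cast
      rw [neg_mul, Real.sin_neg]
      ring
    simp only [e]
    rw [intervalIntegral.integral_neg, this]
    simp
  · simp
  · obtain ⟨n, hn⟩ := Int.eq_ofNat_of_zero_le (a := k - 1) (by lia)
    have hk' : k = ((n + 1 : ℕ) : ℤ) := by push_cast; lia
    rw [sign_pos hk, hk']
    have := integral_cot_half_mul_sin_nat n
    simpa using this

end HilbertIntegral

/-! ### The nonlocal operator acting on trigonometric series. -/

section TrigonometricSeries

/-- The character `θ ↦ e^{ikθ}`. -/
def mode (k : ℤ) (θ : ℝ) : ℂ := Complex.exp (k * θ * Complex.I)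

theorem norm_mode (k : ℤ) (θ : ℝ) : ‖mode k θ‖ = 1 := by
  rw [mode]
  exact_mod_cast Complex.norm_exp_ofReal_mul_I (k * θ)

theorem mode_add (j k : ℤ) (θ : ℝ) : mode (j + k) θ = mode j θ * mode k θ := by
  rw [mode, mode, mode, ← Complex.exp_add]
  push_cast
  ring_nf

theorem mode_add_arg (k : ℤ) (θ s : ℝ) : mode k (θ + s) = mode k θ * mode k s := by
  rw [mode, mode, mode, ← Complex.exp_add]
  push_cast
  ring_nf

theorem mode_zero_right (k : ℤ) : mode k 0 = 1 := by simp [mode]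

theorem mode_eq_cos_add (k : ℤ) (θ : ℝ) :
    mode k θ = (Real.cos (k * θ) : ℂ) + (Real.sin (k * θ) : ℂ) * Complex.I := by
  rw [mode, Complex.exp_mul_I]
  push_cast
  rfl

theorem conj_mode (k : ℤ) (θ : ℝ) : (starRingEnd ℂ) (mode k θ) = mode (-k) θ := by
  rw [mode_eq_cos_add, mode_eq_cos_add, map_add, map_mul, Complex.conj_ofReal, Complex.conj_ofReal,
    Complex.conj_I]
  push_cast
  rw [neg_mul, Complex.cos_neg, Complex.sin_neg]
  ring

theorem hasDerivAt_mode (k : ℤ) (θ : ℝ) :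
    HasDerivAt (mode k) (Complex.I * k * mode k θ) θ := by
  have h : HasDerivAt (fun θ : ℝ => (k : ℂ) * (θ : ℂ) * Complex.I) (k * 1 * Complex.I) θ :=
    ((Complex.ofRealCLM.hasDerivAt (x := θ)).const_mul (k : ℂ)).mul_const _
  convert! h.cexp using 1
  rw [mode]
  ring

theorem continuous_mode (k : ℤ) : Continuous (mode k) :=
  continuous_iff_continuousAt.2 fun θ => (hasDerivAt_mode k θ).continuousAt

theorem mode_periodic (k : ℤ) : Function.Periodic (mode k) (2 * π) := by
  intro θ
  rw [mode, mode, Complex.exp_eq_exp_iff_exists_int]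
  exact ⟨k, by push_cast; ring⟩

theorem cos_two_mul_eq (θ : ℝ) : (Real.cos (2 * θ) : ℂ) = (mode 2 θ + mode (-2) θ) / 2 := by
  rw [mode_eq_cos_add, mode_eq_cos_add]
  push_cast
  rw [neg_mul, Complex.cos_neg, Complex.sin_neg]
  ring

theorem sin_two_mul_eq (θ : ℝ) :
    (Real.sin (2 * θ) : ℂ) = -Complex.I * (mode 2 θ - mode (-2) θ) / 2 := by
  rw [mode_eq_cos_add, mode_eq_cos_add]
  push_cast
  rw [neg_mul 2, Complex.cos_neg, Complex.sin_neg]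
  linear_combination (Complex.sin (2 * θ)) * Complex.I_sq

/-- The real part of the trigonometric series with coefficients `x`. -/
def trigSeries (x : ℤ → ℂ) (θ : ℝ) : ℝ := ∑' k, (x k * mode k θ).re

theorem abs_re_mul_mode_le (z : ℂ) (k : ℤ) (θ : ℝ) : |(z * mode k θ).re| ≤ ‖z‖ := by
  refine (Complex.abs_re_le_norm _).trans ?_
  rw [norm_mul, norm_mode, mul_one]

theorem hasSum_trigSeries {x : ℤ → ℂ} (hx : Summable fun k => ‖x k‖) (θ : ℝ) :
    HasSum (fun k => (x k * mode k θ).re) (trigSeries x θ) :=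
  (Summable.of_norm_bounded hx fun k => abs_re_mul_mode_le _ k θ).hasSum

theorem abs_trigSeries_le {x : ℤ → ℂ} (hx : Summable fun k => ‖x k‖) (θ : ℝ) :
    |trigSeries x θ| ≤ ∑' k, ‖x k‖ :=
  tsum_of_norm_bounded (f := fun k => (x k * mode k θ).re) hx.hasSum
    fun k => abs_re_mul_mode_le _ k θ

theorem trigSeries_periodic (x : ℤ → ℂ) : Function.Periodic (trigSeries x) (2 * π) := by
  intro θ
  simp only [trigSeries, mode_periodic _ θ]

theorem summable_norm_of_rho {x : ℤ → ℂ} (hx : Summable fun k => rho k * ‖x k‖) {c : ℤ → ℂ}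
    (hc : ∀ k, ‖c k‖ ≤ rho k) : Summable fun k => ‖c k * x k‖ :=
  hx.of_nonneg_of_le (fun k => norm_nonneg _) fun k => by
    rw [norm_mul]
    exact mul_le_mul_of_nonneg_right (hc k) (norm_nonneg _)

theorem summable_norm_of_mul_rho {x : ℤ → ℂ} (hx : Summable fun k => rho k * ‖x k‖) {c : ℤ → ℂ}
    {C : ℝ} (hc : ∀ k, ‖c k‖ ≤ C * rho k) : Summable fun k => ‖c k * x k‖ :=
  (hx.mul_left C).of_nonneg_of_le (fun k => norm_nonneg _) fun k => by
    rw [norm_mul, ← mul_assoc]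
    exact mul_le_mul_of_nonneg_right (hc k) (norm_nonneg _)

theorem summable_norm_of_rho' {x : ℤ → ℂ} (hx : Summable fun k => rho k * ‖x k‖) :
    Summable fun k => ‖x k‖ := by
  simpa using summable_norm_of_rho hx (c := fun _ => 1) fun k => by simpa using one_le_rho k

theorem norm_I_mul_int (k : ℤ) : ‖Complex.I * (k : ℂ)‖ = |(k : ℝ)| := by
  rw [norm_mul, Complex.norm_I, one_mul, Complex.norm_intCast]

theorem norm_I_mul_int_le (k : ℤ) : ‖Complex.I * (k : ℂ)‖ ≤ rho k :=
  (norm_I_mul_int k).trans_le (abs_le_rho k)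

theorem hasDerivAt_trigSeries {x : ℤ → ℂ} (hx : Summable fun k => rho k * ‖x k‖) (θ : ℝ) :
    HasDerivAt (trigSeries x) (trigSeries (fun k => Complex.I * k * x k) θ) θ := by
  refine hasDerivAt_tsum (g := fun k θ => (x k * mode k θ).re)
    (g' := fun k θ => (Complex.I * k * x k * mode k θ).re) (y₀ := 0)
    (summable_norm_of_rho hx norm_I_mul_int_le) (fun k y => ?_)
    (fun k y => abs_re_mul_mode_le _ k y)
    (hasSum_trigSeries (summable_norm_of_rho' hx) 0).summable θ
  have h := (hasDerivAt_mode k y).const_mul (x k)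
  have h2 := Complex.reCLM.hasFDerivAt.comp_hasDerivAt y h
  convert! h2 using 1
  simp only [Complex.reCLM_apply]
  ring_nf

theorem abs_trigSeries_sub_le {x : ℤ → ℂ} (hx : Summable fun k => rho k * ‖x k‖) (a b : ℝ) :
    |trigSeries x a - trigSeries x b| ≤ (∑' k, ‖Complex.I * k * x k‖) * |a - b| :=
  convex_univ.norm_image_sub_le_of_norm_hasDerivWithin_le (f := trigSeries x)
    (fun θ _ => (hasDerivAt_trigSeries hx θ).hasDerivWithinAt)
    (fun θ _ => abs_trigSeries_le (summable_norm_of_rho hx norm_I_mul_int_le) θ)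
    (mem_univ b) (mem_univ a)

theorem norm_neg_I_mul_sign_le (k : ℤ) : ‖-Complex.I * ((SignType.sign k : ℝ) : ℂ)‖ ≤ 1 := by
  rw [norm_mul, norm_neg, Complex.norm_I, one_mul, Complex.norm_real]
  exact abs_sign_le k

theorem re_mul_mode_sub (z : ℂ) (k : ℤ) (θ s : ℝ) :
    (z * mode k (θ - s)).re - (z * mode k (θ + s)).re
      = 2 * (z * mode k θ).im * Real.sin (k * s) := by
  rw [sub_eq_add_neg θ s, mode_add_arg, mode_add_arg, mode_eq_cos_add k s,
    mode_eq_cos_add k (-s), mul_neg, Real.cos_neg, Real.sin_neg, ← mul_assoc, ← mul_assoc]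
  generalize z * mode k θ = a
  simp only [Complex.mul_re, Complex.add_re, Complex.add_im, Complex.mul_im, Complex.ofReal_re,
    Complex.ofReal_im, Complex.I_re, Complex.I_im]
  ring

/-- The folded integral of each mode reduces to `cot(s/2) sin(ks)`. Since `|cot(s/2) sin(ks)| ≤ π
rho k`, the assumed summability justifies termwise integration. -/
theorem hilbertInt_trigSeries {x : ℤ → ℂ} (hx : Summable fun k => rho k * ‖x k‖) (θ : ℝ) :
    hilbertInt (trigSeries x) θ
      = trigSeries (fun k => -Complex.I * ((SignType.sign k : ℝ) : ℂ) * x k) θ := by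
  have hx0 := summable_norm_of_rho' hx
  set f : ℤ → ℝ → ℝ := fun k s =>
    2 * (x k * mode k θ).im * (Real.cot (s / 2) * Real.sin (k * s)) with hf
  have hbound (k : ℤ) (s : ℝ) (h0 : 0 < s) (h1 : s ≤ π) :
      ‖f k s‖ ≤ 2 * π * (rho k * ‖x k‖) := by
    have h2 := abs_cot_half_mul_le (g := fun s => Real.sin (k * s)) (M := rho k) (s := s) (by
      refine Real.abs_sin_le_abs.trans ?_
      rw [abs_mul, abs_of_pos h0]
      gcongr
      exact abs_le_rho k) h0 h1
    have h3 : |(x k * mode k θ).im| ≤ ‖x k‖ := by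
      refine (Complex.abs_im_le_norm _).trans ?_
      rw [norm_mul, norm_mode, mul_one]
    rw [hf, Real.norm_eq_abs]
    simp only
    rw [abs_mul, abs_mul, abs_two]
    calc _ ≤ 2 * ‖x k‖ * (π * rho k) := by gcongr
      _ = _ := by ring
  have key := intervalIntegral.hasSum_integral_of_dominated_convergence (μ := volume)
    (a := 0) (b := π) (F := f)
    (f := fun s => Real.cot (s / 2) * (trigSeries x (θ - s) - trigSeries x (θ + s)))
    (fun k _ => 2 * π * (rho k * ‖x k‖))
    (fun k => ((measurable_cot_half.mul (by fun_prop)).const_mul _).aestronglyMeasurable)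
    (fun k => Eventually.of_forall fun s hs => by
      rw [uIoc_of_le pi_pos.le] at hs
      exact hbound k s hs.1 hs.2)
    (Eventually.of_forall fun s _ => hx.mul_left _)
    intervalIntegrable_const
    (Eventually.of_forall fun s _ => by
      have h := ((hasSum_trigSeries hx0 (θ - s)).sub (hasSum_trigSeries hx0 (θ + s))).mul_left
        (Real.cot (s / 2))
      convert! h using 2 with k
      rw [re_mul_mode_sub]
      ring)
  rw [hilbertInt, ← (key.mul_left (1 / (2 * π))).tsum_eq, trigSeries]
  refine tsum_congr fun k => ?_
  rw [hf, intervalIntegral.integral_const_mul, integral_cot_half_mul_sin,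
    show -Complex.I * ((SignType.sign k : ℝ) : ℂ) * x k * mode k θ
      = ((SignType.sign k : ℝ) : ℂ) * (-Complex.I * (x k * mode k θ)) by ring,
    Complex.re_ofReal_mul]
  simp only [neg_mul, Complex.neg_re, Complex.I_mul_re, neg_neg]
  field_simp

theorem hasHilbertAt_trigSeries {x : ℤ → ℂ} (hx : Summable fun k => rho k * ‖x k‖) (θ : ℝ) :
    HasHilbertAt (trigSeries x) θ
      (trigSeries (fun k => -Complex.I * ((SignType.sign k : ℝ) : ℂ) * x k) θ) := by
  rw [← hilbertInt_trigSeries hx]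
  exact hasHilbertAt_hilbertInt (abs_trigSeries_sub_le hx) θ

/-- The coefficients of `Lη` in terms of the coefficients of `η`. -/
def linSeq (x : ℤ → ℂ) (j : ℤ) : ℂ :=
  upCoeff (fun k => (k : ℝ)) 0 j * x (j - 2) + downCoeff (fun k => (k : ℝ)) 0 j * x (j + 2)
    - (∑' k : ℤ, ((1 / |(k : ℝ)| : ℝ) : ℂ) * x k) * cosSeq j

/-- The coefficients of `v` up to a constant. -/
def velSeq (x : ℤ → ℂ) (k : ℤ) : ℂ := -((1 / |(k : ℝ)| : ℝ) : ℂ) * x k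

theorem norm_inv_abs_le (k : ℤ) : ‖((1 / |(k : ℝ)| : ℝ) : ℂ)‖ ≤ 1 := by
  rw [Complex.norm_real, Real.norm_eq_abs, abs_of_nonneg (by positivity)]
  exact one_div_abs_le k

theorem summable_velSeq {x : ℤ → ℂ} (hx : Summable fun k => rho k * ‖x k‖) :
    Summable fun k => rho k * ‖velSeq x k‖ :=
  hx.of_nonneg_of_le (fun k => mul_nonneg (rho_pos k).le (norm_nonneg _)) fun k => by
    have := rho_pos k
    rw [velSeq, norm_mul, norm_neg]
    gcongr
    exact mul_le_of_le_one_left (norm_nonneg _) (norm_inv_abs_le k)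

theorem hasDerivAt_velSeq {x : ℤ → ℂ} (hx : Summable fun k => rho k * ‖x k‖) (θ : ℝ) :
    HasDerivAt (fun θ => trigSeries (velSeq x) θ - trigSeries (velSeq x) 0)
      (trigSeries (fun k => -Complex.I * ((SignType.sign k : ℝ) : ℂ) * x k) θ) θ := by
  convert! (hasDerivAt_trigSeries (summable_velSeq hx) θ).sub_const _ using 2
  funext k
  have h : (SignType.sign k : ℝ) = k * (1 / |(k : ℝ)|) := by
    rcases lt_trichotomy k 0 with hk | rfl | hk
    · have hk' : (k : ℝ) < 0 := by exact_mod_cast hk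
      rw [sign_neg hk, abs_of_neg hk']
      field_simp
      simp [hk'.ne]
    · simp
    · have hk' : (0 : ℝ) < k := by exact_mod_cast hk
      rw [sign_pos hk, abs_of_pos hk']
      field_simp
      simp
  rw [h, velSeq]
  push_cast
  ring

/-- Multiplication by `sin 2θ` and `cos 2θ` shifts modes by `±2`, and the velocity coefficient of
mode `k` is `-1/|k|`. The `-1` in `mode k θ - 1` enforces the gauge and produces the rank-one term.
At `k = 0` the convention `1/0 = 0` is the correct value, since a constant has zero Hilbert
transform. -/
theorem lin_mode_identity (k : ℤ) (θ : ℝ) :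
    1 / 2 * (Real.sin (2 * θ) : ℂ) * (Complex.I * k * mode k θ) - Real.cos (2 * θ) * mode k θ
      + Real.sin (2 * θ) * (-Complex.I * ((SignType.sign k : ℝ) : ℂ) * mode k θ)
      + 2 * Real.cos (2 * θ) * (((1 / |(k : ℝ)| : ℝ) : ℂ) * (mode k θ - 1))
    = ((k / 4 + lowUp k : ℝ) : ℂ) * mode (k + 2) θ + ((-(k / 4) + lowDown k : ℝ) : ℂ)
      * mode (k + (-2)) θ - ((1 / |(k : ℝ)| : ℝ) : ℂ) * (mode 2 θ + mode (-2) θ) := by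
  rw [cos_two_mul_eq, sin_two_mul_eq, mode_add, mode_add, lowUp, lowDown]
  push_cast
  linear_combination (mode k θ * (mode 2 θ - mode (-2) θ)
    * (-(k : ℂ) / 4 + ((SignType.sign k : ℝ) : ℂ) / 2)) * Complex.I_sq

theorem linOp_trigSeries {x : ℤ → ℂ} (hx : Summable fun k => rho k * ‖x k‖) (θ : ℝ) :
    linOp (trigSeries x) (fun θ => trigSeries (velSeq x) θ - trigSeries (velSeq x) 0) θ
      = trigSeries (linSeq x) θ := by
  have hx0 := summable_norm_of_rho' hx
  have hv0 := summable_norm_of_rho' (summable_velSeq hx)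
  have hH : Summable fun k => ‖-Complex.I * ((SignType.sign k : ℝ) : ℂ) * x k‖ :=
    summable_norm_of_rho hx fun k => (norm_neg_I_mul_sign_le k).trans (one_le_rho k)
  have hD : Summable fun k => ‖Complex.I * k * x k‖ := summable_norm_of_rho hx norm_I_mul_int_le
  rw [linOp, (hasDerivAt_trigSeries hx θ).deriv, (hasHilbertAt_trigSeries hx θ).hilbert_eq]
  have h1 := (((hasSum_trigSeries hD θ).mul_left (1 / 2 * Real.sin (2 * θ))).sub
    ((hasSum_trigSeries hx0 θ).mul_left (Real.cos (2 * θ)))).add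
    ((hasSum_trigSeries hH θ).mul_left (Real.sin (2 * θ))) |>.sub
    (((hasSum_trigSeries hv0 θ).sub (hasSum_trigSeries hv0 0)).mul_left (2 * Real.cos (2 * θ)))
  have hup : Summable fun k : ℤ => ‖((k / 4 + lowUp k : ℝ) : ℂ) * x k‖ := by
    refine summable_norm_of_mul_rho hx (C := 3) fun k => ?_
    rw [Complex.norm_real, Real.norm_eq_abs]
    refine (abs_add_le _ _).trans ?_
    rw [abs_div, abs_of_pos (by norm_num : (0 : ℝ) < 4)]
    linarith [abs_lowUp_le k, abs_le_rho k, one_le_rho k]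
  have hdown : Summable fun k : ℤ => ‖((-(k / 4) + lowDown k : ℝ) : ℂ) * x k‖ := by
    refine summable_norm_of_mul_rho hx (C := 3) fun k => ?_
    rw [Complex.norm_real, Real.norm_eq_abs]
    refine (abs_add_le _ _).trans ?_
    rw [abs_neg, abs_div, abs_of_pos (by norm_num : (0 : ℝ) < 4)]
    linarith [abs_lowDown_le k, abs_le_rho k, one_le_rho k]
  have hg : Summable fun k : ℤ => ((1 / |(k : ℝ)| : ℝ) : ℂ) * x k := by
    refine Summable.of_norm ?_
    exact summable_norm_of_rho hx fun k => (norm_inv_abs_le k).trans (one_le_rho k)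
  have up' : Summable fun k : ℤ => ((k / 4 + lowUp k : ℝ) : ℂ) * x k * mode (k + 2) θ :=
    Summable.of_norm (hup.congr fun k => by rw [norm_mul _ (mode _ _), norm_mode, mul_one])
  have down' : Summable fun k : ℤ => ((-(k / 4) + lowDown k : ℝ) : ℂ) * x k * mode (k + (-2)) θ :=
    Summable.of_norm (hdown.congr fun k => by rw [norm_mul _ (mode _ _), norm_mode, mul_one])
  have hcos : HasSum (fun j => cosSeq j * mode j θ) (mode 2 θ + mode (-2) θ) := by
    have := hasSum_sum_of_ne_finset_zero (L := SummationFilter.unconditional ℤ) (f := fun j => cosSeq j * mode j θ) (s := {2, -2})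
      (fun j hj => by
        simp only [Finset.mem_insert, Finset.mem_singleton] at hj
        rw [cosSeq_apply, if_neg hj, zero_mul])
    simpa [cosSeq_apply] using this
  -- Reindexing by the target mode `j = k + 2` (and by `j = k - 2` below) turns sums over source
  -- modes into sums against `mode j`.
  have r1 := (Equiv.addRight (2 : ℤ)).hasSum_iff (f := fun j =>
    (upCoeff (fun k => (k : ℝ)) 0 j : ℂ) * x (j - 2) * mode j θ)
    (a := ∑' k : ℤ, ((k / 4 + lowUp k : ℝ) : ℂ) * x k * mode (k + 2) θ)
  have r1 := r1.1 (by
    convert! up'.hasSum using 2 with k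
    simp [upCoeff])
  have r2 := (Equiv.addRight (-2 : ℤ)).hasSum_iff (f := fun j =>
    (downCoeff (fun k => (k : ℝ)) 0 j : ℂ) * x (j + 2) * mode j θ)
    (a := ∑' k : ℤ, ((-(k / 4) + lowDown k : ℝ) : ℂ) * x k * mode (k + (-2)) θ)
  have r2 := r2.1 (by
    convert! down'.hasSum using 2 with k
    simp [downCoeff])
  have r3 := hcos.mul_left (∑' k : ℤ, ((1 / |(k : ℝ)| : ℝ) : ℂ) * x k)
  have r : HasSum (fun j => linSeq x j * mode j θ)
      ((∑' k : ℤ, ((k / 4 + lowUp k : ℝ) : ℂ) * x k * mode (k + 2) θ)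
        + (∑' k : ℤ, ((-(k / 4) + lowDown k : ℝ) : ℂ) * x k * mode (k + (-2)) θ)
        - (∑' k : ℤ, ((1 / |(k : ℝ)| : ℝ) : ℂ) * x k) * (mode 2 θ + mode (-2) θ)) := by
    convert! ((r1.add r2).sub r3) using 2 with j
    rw [linSeq]
    ring
  have r' := Complex.hasSum_re r
  have r2' : trigSeries (linSeq x) θ = _ := r'.tsum_eq
  rw [r2']
  have l := (up'.hasSum.add down'.hasSum).sub (hg.hasSum.mul_right (mode 2 θ + mode (-2) θ))
  have l' := Complex.hasSum_re l
  -- The comparison is made term by term over the source mode `k`. All the multiplying functions of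
  -- `θ` are real, so the complex identity passes to real parts.
  refine h1.unique ?_
  convert! l' using 1
  funext k
  have h2 := congrArg (fun z : ℂ => (x k * z).re) (lin_mode_identity k θ)
  have e1 : x k * (1 / 2 * (Real.sin (2 * θ) : ℂ) * (Complex.I * k * mode k θ)
      - Real.cos (2 * θ) * mode k θ
      + Real.sin (2 * θ) * (-Complex.I * ((SignType.sign k : ℝ) : ℂ) * mode k θ)
      + 2 * Real.cos (2 * θ) * (((1 / |(k : ℝ)| : ℝ) : ℂ) * (mode k θ - 1)))
      = ((1 / 2 * Real.sin (2 * θ) : ℝ) : ℂ) * (Complex.I * k * x k * mode k θ)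
        - (Real.cos (2 * θ) : ℂ) * (x k * mode k θ)
        + (Real.sin (2 * θ) : ℂ) * (-Complex.I * ((SignType.sign k : ℝ) : ℂ) * x k * mode k θ)
        - ((2 * Real.cos (2 * θ) : ℝ) : ℂ) * (velSeq x k * mode k θ - velSeq x k * mode k 0) := by
    rw [velSeq, mode_zero_right]
    push_cast
    ring
  simp only [e1] at h2
  simp only [Complex.sub_re, Complex.add_re, Complex.re_ofReal_mul] at h2
  rw [h2]
  congr 1
  ring

end TrigonometricSeries

/-! ### From curves in `ℓ²` to classical functions of `(t, θ)`. -/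

section ClassicalRegularity

theorem summable_inv_rho_sq : Summable fun k : ℤ => (rho k ^ 2)⁻¹ := by
  have h : Summable fun k : ℤ => 1 / (k : ℝ) ^ 2 + if k = 0 then (1 : ℝ) else 0 :=
    (Real.summable_one_div_int_pow.2 (by norm_num)).add (hasSum_ite_eq (0 : ℤ) (1 : ℝ)).summable
  refine h.of_nonneg_of_le (fun k => by positivity) fun k => ?_
  rcases eq_or_ne k 0 with rfl | hk
  · simp [rho]
  · have hk' : (0 : ℝ) < |(k : ℝ)| := by positivity
    rw [if_neg hk, add_zero, one_div, ← sq_abs (k : ℝ)]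
    have := abs_le_rho k
    gcongr

theorem summable_of_le_inv_rho_sq {f : ℤ → ℝ} (C : ℝ) (h0 : ∀ k, 0 ≤ f k)
    (h : ∀ k, f k ≤ C * (rho k ^ 2)⁻¹) : Summable f :=
  (summable_inv_rho_sq.mul_left C).of_nonneg_of_le h0 h

theorem inv_rho_pow_le {r s : ℕ} (h : r ≤ s) (k : ℤ) : (rho k ^ s)⁻¹ ≤ (rho k ^ r)⁻¹ := by
  have := rho_pos k
  have := one_le_rho k
  gcongr

theorem norm_wt_apply (s : ℕ) (y : Seq) (k : ℤ) : ‖wt s y k‖ = (rho k ^ s)⁻¹ * ‖y k‖ := by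
  rw [wt_apply, norm_mul, norm_inv, norm_pow, Complex.norm_real, Real.norm_eq_abs,
    abs_of_pos (rho_pos k)]

theorem summable_rho_mul_wt {s : ℕ} (hs : 3 ≤ s) (y : Seq) :
    Summable fun k => rho k * ‖wt s y k‖ := by
  refine summable_of_le_inv_rho_sq ‖y‖ (fun k => mul_nonneg (rho_pos k).le (norm_nonneg _))
    fun k => ?_
  have h1 := lp.norm_apply_le_norm (by norm_num) y k
  have h2 := inv_rho_pow_le hs k
  have h3 := rho_pos k
  rw [norm_wt_apply]
  calc rho k * ((rho k ^ s)⁻¹ * ‖y k‖) ≤ rho k * ((rho k ^ 3)⁻¹ * ‖y‖) := by gcongr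
    _ = _ := by field_simp

theorem memℓp_evalSeq (n : ℕ) (θ : ℝ) :
    Memℓp (fun k : ℤ => mode (-k) θ * ((rho k ^ (n + 3))⁻¹ : ℝ)) 2 := by
  rw [memℓp_two_iff]
  refine summable_of_le_inv_rho_sq 1 (fun k => by positivity) fun k => ?_
  rw [norm_mul, norm_mode, one_mul, Complex.norm_real, Real.norm_eq_abs, one_mul]
  have h := abs_inv_rho_pow_le (n + 3) k
  have h2 := inv_rho_pow_le (show 2 ≤ n + 3 by lia) k
  have h3 : |(rho k ^ (n + 3))⁻¹| = (rho k ^ (n + 3))⁻¹ :=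
    abs_of_nonneg (inv_nonneg.2 (pow_nonneg (rho_pos k).le _))
  nlinarith [abs_nonneg ((rho k ^ (n + 3))⁻¹)]

/-- The sequence representing evaluation at `θ` at level `n + 3`. -/
def evalSeq (n : ℕ) (θ : ℝ) : Seq := ⟨_, memℓp_evalSeq n θ⟩

theorem re_inner_evalSeq (n : ℕ) (θ : ℝ) (z : Seq) :
    (inner ℂ (evalSeq n θ) z).re = trigSeries (wt (n + 3) z) θ := by
  have h := lp.hasSum_inner (𝕜 := ℂ) (evalSeq n θ) z
  refine ((Complex.hasSum_re h).tsum_eq.symm.trans ?_)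
  rw [trigSeries]
  refine tsum_congr fun k => ?_
  have e : evalSeq n θ k = mode (-k) θ * ((rho k ^ (n + 3))⁻¹ : ℝ) := rfl
  rw [e, wt_apply, RCLike.inner_apply, map_mul, conj_mode, neg_neg, Complex.conj_ofReal]
  push_cast
  ring_nf

/-- The series differentiated term by term is dominated by `|k| (1 + |k|)^{-(n+3)}`, which is
summable. -/
theorem contDiff_evalSeq (n : ℕ) : ContDiff ℝ 1 (evalSeq n) := by
  set S : (k : ℤ) → ℂ →L[ℝ] Seq := fun k =>
    (lp.singleContinuousLinearMap ℂ (fun _ : ℤ => ℂ) 2 k).restrictScalars ℝ with hS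
  have hSn (k : ℤ) (z : ℂ) : ‖S k z‖ = ‖z‖ :=
    lp.norm_single (E := fun _ : ℤ => ℂ) (p := 2) (by norm_num) k z
  set c : ℤ → ℂ := fun k => ((rho k ^ (n + 3))⁻¹ : ℝ) with hc
  have hcn (k : ℤ) : ‖c k‖ = (rho k ^ (n + 3))⁻¹ := by
    rw [hc, Complex.norm_real, Real.norm_eq_abs,
      abs_of_nonneg (inv_nonneg.2 (pow_nonneg (rho_pos k).le _))]
  have e : evalSeq n = fun θ => ∑' k, S k (mode (-k) θ * c k) := by
    funext θ
    exact (lp.hasSum_single (by norm_num) (evalSeq n θ)).tsum_eq.symm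
  have hu : Summable fun k : ℤ => |(k : ℝ)| * ‖c k‖ := by
    refine summable_of_le_inv_rho_sq 1 (fun k => by positivity) fun k => ?_
    have h2 := inv_rho_pow_le (show 3 ≤ n + 3 by lia) k
    have h3 := rho_pos k
    rw [hcn]
    calc _ ≤ rho k * (rho k ^ 3)⁻¹ := by
          gcongr
          exact abs_le_rho k
      _ = _ := by field_simp
  have hn (k : ℤ) (θ : ℝ) :
      ‖S k (Complex.I * (-k : ℤ) * mode (-k) θ * c k)‖ ≤ |(k : ℝ)| * ‖c k‖ := by
    rw [hSn, norm_mul, norm_mul, norm_mode, mul_one, norm_I_mul_int]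
    simp
  have hd (θ : ℝ) : HasDerivAt (evalSeq n)
      (∑' k, S k (Complex.I * (-k : ℤ) * mode (-k) θ * c k)) θ := by
    rw [e]
    refine hasDerivAt_tsum (g := fun k θ => S k (mode (-k) θ * c k)) (y₀ := 0) hu
      (fun k y => ?_) hn (lp.hasSum_single (by norm_num) (evalSeq n 0)).summable θ
    exact (S k).hasFDerivAt.comp_hasDerivAt y ((hasDerivAt_mode (-k) y).mul_const (c k))
  rw [contDiff_one_iff_deriv]
  refine ⟨fun θ => (hd θ).differentiableAt, ?_⟩
  rw [funext fun θ => (hd θ).deriv]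
  refine continuous_tsum (fun k => ?_) hu hn
  have := continuous_mode (-k)
  have := (S k).continuous
  fun_prop

/-- Evaluation is an inner product of a `C¹` curve in `θ` with a `C¹` curve in `t`, so joint
regularity follows from smoothness of the inner product. -/
theorem contDiff_trigSeries_wt {n : ℕ} {z : ℝ → Seq} (hz : ContDiff ℝ 1 z) :
    ContDiff ℝ 1 fun p : ℝ × ℝ => trigSeries (wt (n + 3) (z p.1)) p.2 := by
  simp only [← re_inner_evalSeq]
  exact Complex.reCLM.contDiff.comp (((contDiff_evalSeq n).comp contDiff_snd).inner ℂ
    (hz.comp contDiff_fst))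

theorem hasDerivAt_trigSeries_wt {n : ℕ} {z : ℝ → Seq} {z' : Seq} {t : ℝ} (hz : HasDerivAt z z' t)
    (θ : ℝ) : HasDerivAt (fun t => trigSeries (wt (n + 3) (z t)) θ)
      (trigSeries (wt (n + 3) z') θ) t := by
  simp only [← re_inner_evalSeq]
  have := Complex.reCLM.hasFDerivAt.comp_hasDerivAt t
    (((innerSL ℂ (evalSeq n θ)).restrictScalars ℝ).hasFDerivAt.comp_hasDerivAt t hz)
  exact this

/-- `smoothGen` already carries one factor `rho⁻¹`; the remaining `s` weights complete
`rho^{-(s+1)}` and undo the conjugation. -/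
theorem wt_smoothGen_apply (s : ℕ) (y : Seq) (j : ℤ) :
    wt s (smoothGen (s + 1) y) j = linSeq (wt (s + 1) y) j := by
  have h1 := congrArg (fun x : ℝ => (x : ℂ)) (upCoeff_mul (fun k => (k : ℝ)) 0 (s + 1) j)
  have h2 := congrArg (fun x : ℝ => (x : ℂ)) (downCoeff_mul (fun k => (k : ℝ)) 0 (s + 1) j)
  have h3 := congrArg (fun x : Seq => x j) (gaugeOp_wt 0 (s + 1) y)
  push_cast at h1 h2
  simp only [wt_apply, gaugeOp_apply, inner_gaugeSeq, wt_zero_apply, pow_zero, one_mul,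
    zero_add] at h1 h2 h3
  rw [linSeq, wt_apply, smoothGen_apply, wt_apply, wt_apply, gaugeOp_apply, inner_gaugeSeq]
  have h4 := ofReal_rho_ne_zero j
  simp only [pow_succ, mul_inv] at h1 h2 h3 ⊢
  simp only [wt_apply, pow_succ, mul_inv] at h1 h2 h3 ⊢
  linear_combination (-y (j - 2)) * h1 - y (j + 2) * h2 + h3

theorem trigSeries_neg (x : ℤ → ℂ) (θ : ℝ) : trigSeries (fun k => -x k) θ = -trigSeries x θ := by
  rw [trigSeries, trigSeries, ← tsum_neg]
  refine tsum_congr fun k => ?_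
  rw [neg_mul, Complex.neg_re]

/-- The trigonometric series of a Fourier solution satisfies the evolution equation. -/
theorem hasDerivAt_evolution {n : ℕ} {y : ℝ → Seq}
    (h : ∀ t, HasDerivAt (fun τ => wt 1 (y τ)) (-smoothGen (n + 4) (y t)) t) (t θ : ℝ) :
    HasDerivAt (fun t => trigSeries (wt (n + 4) (y t)) θ)
      (-linOp (trigSeries (wt (n + 4) (y t))) (fun θ => trigSeries (velSeq (wt (n + 4) (y t))) θ
        - trigSeries (velSeq (wt (n + 4) (y t))) 0) θ) t := by
  have h1 := hasDerivAt_trigSeries_wt (n := n) (h t) θ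
  simp only [wt_add_apply] at h1
  rw [linOp_trigSeries (summable_rho_mul_wt (by lia) _), ← trigSeries_neg]
  convert! h1 using 2
  funext k
  rw [map_neg, Seq.neg_apply, wt_smoothGen_apply]

end ClassicalRegularity

/-! ### Fourier series in `L²` and the weighted description of the Sobolev spaces. -/

section FourierBasis

theorem neg_pi_le_pi : -π ≤ π := by linarith [pi_pos]

theorem neg_pi_lt_pi : -π < π := by linarith [pi_pos]

/-- The Fourier coefficients of a function on `(-π, π]`. -/
def coeff (f : ℝ → ℂ) (k : ℤ) : ℂ := 1 / (2 * π) * ∫ θ in (-π)..π, mode (-k) θ * f θ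

theorem coeff_eq_fourierCoeffOn (f : ℝ → ℂ) (k : ℤ) :
    coeff f k = fourierCoeffOn neg_pi_lt_pi f k := by
  rw [fourierCoeffOn_eq_integral, coeff, Complex.real_smul]
  congr 1
  · push_cast; ring
  · refine intervalIntegral.integral_congr fun θ _ => ?_
    have hp : (π : ℂ) ≠ 0 := by exact_mod_cast pi_ne_zero
    simp only [fourier_coe_apply, smul_eq_mul, mode]
    congr 2
    push_cast
    field_simp
    ring

theorem hasSum_sq_coeff {f : ℝ → ℂ} (hf : MemLp f 2 torusMeasure) :
    HasSum (fun k => ‖coeff f k‖ ^ 2) ((2 * π)⁻¹ * ∫ θ in (-π)..π, ‖f θ‖ ^ 2) := by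
  have := hasSum_sq_fourierCoeffOn neg_pi_lt_pi hf
  simp only [coeff_eq_fourierCoeffOn]
  convert! this using 2
  ring

theorem integral_mode {k : ℤ} (hk : k ≠ 0) : ∫ θ in (-π)..π, mode k θ = 0 := by
  have hk' : Complex.I * (k : ℂ) ≠ 0 := mul_ne_zero Complex.I_ne_zero (by exact_mod_cast hk)
  have hd (θ : ℝ) : HasDerivAt (fun θ => (Complex.I * (k : ℂ))⁻¹ * mode k θ) (mode k θ) θ := by
    convert! (hasDerivAt_mode k θ).const_mul (Complex.I * (k : ℂ))⁻¹ using 1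
    field_simp
  rw [intervalIntegral.integral_eq_sub_of_hasDerivAt (fun θ _ => hd θ)
    ((continuous_mode k).intervalIntegrable _ _)]
  have := mode_periodic k (-π)
  rw [show -π + 2 * π = π by ring] at this
  rw [this, sub_self]

theorem mode_zero_left (θ : ℝ) : mode 0 θ = 1 := by simp [mode]

/-- The character as a bounded continuous function. -/
def modeBounded (k : ℤ) : BoundedContinuousFunction ℝ ℂ :=
  BoundedContinuousFunction.ofNormedAddCommGroup (mode k) (continuous_mode k) 1
    fun θ => (norm_mode k θ).le

/-- The character as an element of `L²`. -/
def modeLp (k : ℤ) : Lp ℂ 2 torusMeasure :=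
  BoundedContinuousFunction.toLp 2 torusMeasure ℂ (modeBounded k)

theorem coeFn_modeLp (k : ℤ) : modeLp k =ᵐ[torusMeasure] mode k :=
  BoundedContinuousFunction.coeFn_toLp 2 torusMeasure ℂ (modeBounded k)

theorem inner_modeLp (k : ℤ) (f : Lp ℂ 2 torusMeasure) :
    inner ℂ (modeLp k) f = 2 * π * coeff f k := by
  have hp : (π : ℂ) ≠ 0 := by exact_mod_cast pi_ne_zero
  rw [coeff, L2.inner_def, intervalIntegral.integral_of_le neg_pi_le_pi, ← mul_assoc,
    mul_one_div_cancel (by simp [hp]), one_mul]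
  refine MeasureTheory.integral_congr_ae ?_
  filter_upwards [coeFn_modeLp k] with θ hθ
  rw [hθ, RCLike.inner_apply, conj_mode, mul_comm]

theorem coeff_congr {f g : ℝ → ℂ} (h : f =ᵐ[torusMeasure] g) (k : ℤ) : coeff f k = coeff g k := by
  rw [coeff, coeff, intervalIntegral.integral_of_le neg_pi_le_pi,
    intervalIntegral.integral_of_le neg_pi_le_pi]
  congr 1
  refine MeasureTheory.integral_congr_ae ?_
  filter_upwards [h] with θ hθ
  rw [hθ]

theorem coeff_mode (j k : ℤ) : coeff (mode j) k = if k = j then 1 else 0 := by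
  have hp : (π : ℂ) ≠ 0 := by exact_mod_cast pi_ne_zero
  have e (θ : ℝ) : mode (-k) θ * mode j θ = mode (j - k) θ := by
    rw [← mode_add]; ring_nf
  simp only [coeff, e]
  split_ifs with h
  · subst h
    simp only [sub_self, mode_zero_left]
    rw [intervalIntegral.integral_const]
    simp
    field_simp
    norm_num
  · rw [integral_mode (sub_ne_zero.2 (Ne.symm h)), mul_zero]

theorem ofReal_sqrt_two_pi_ne_zero : ((√(2 * π) : ℝ) : ℂ) ≠ 0 := by
  exact_mod_cast (Real.sqrt_pos.2 (by positivity)).ne'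

theorem ofReal_sqrt_two_pi_mul_self : ((√(2 * π) : ℝ) : ℂ) * (√(2 * π) : ℝ) = 2 * π := by
  rw [← Complex.ofReal_mul, Real.mul_self_sqrt (by positivity)]
  push_cast
  rfl

theorem orthonormal_modeLp :
    Orthonormal ℂ fun k : ℤ => ((√(2 * π) : ℝ) : ℂ)⁻¹ • modeLp k := by
  rw [orthonormal_iff_ite]
  intro j k
  rw [inner_smul_left, inner_smul_right, inner_modeLp, coeff_congr (coeFn_modeLp k), coeff_mode,
    map_inv₀, Complex.conj_ofReal, ← ofReal_sqrt_two_pi_mul_self]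
  have := ofReal_sqrt_two_pi_ne_zero
  split_ifs <;> field_simp

theorem eq_zero_of_coeff_eq_zero {f : ℝ → ℂ} (hf : MemLp f 2 torusMeasure)
    (h : ∀ k, coeff f k = 0) : f =ᵐ[torusMeasure] 0 := by
  have h1 := hasSum_sq_coeff hf
  simp only [h, norm_zero, ne_eq, OfNat.ofNat_ne_zero, not_false_eq_true, zero_pow] at h1
  have h2 := h1.unique hasSum_zero
  have h3 : ∫ θ in (-π)..π, ‖f θ‖ ^ 2 = 0 := by
    rcases mul_eq_zero.1 h2 with h' | h'
    · exact absurd h' (by positivity)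
    · exact h'
  rw [intervalIntegral.integral_of_le neg_pi_le_pi, integral_eq_zero_iff_of_nonneg
    (fun θ => by positivity) (hf.integrable_norm_pow (by norm_num))] at h3
  filter_upwards [h3] with θ hθ
  simpa using hθ

/-- The Hilbert basis of normalized characters. -/
def fourierHilbertBasis : HilbertBasis ℤ ℂ (Lp ℂ 2 torusMeasure) :=
  HilbertBasis.mkOfOrthogonalEqBot orthonormal_modeLp (by
    rw [Submodule.eq_bot_iff]
    intro f hf
    rw [Submodule.mem_orthogonal] at hf
    rw [Lp.eq_zero_iff_ae_eq_zero]
    refine eq_zero_of_coeff_eq_zero (Lp.memLp f) fun k => ?_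
    have h1 := hf _ (Submodule.subset_span ⟨k, rfl⟩)
    rw [inner_smul_left, inner_modeLp] at h1
    have hp : (π : ℂ) ≠ 0 := by exact_mod_cast pi_ne_zero
    have h2 := ofReal_sqrt_two_pi_ne_zero
    rw [map_inv₀, Complex.conj_ofReal, mul_eq_zero, mul_eq_zero] at h1
    simpa only [inv_eq_zero, h2, mul_eq_zero, OfNat.ofNat_ne_zero, hp, or_self, false_or] using h1)

theorem fourierHilbertBasis_apply (k : ℤ) :
    fourierHilbertBasis k = ((√(2 * π) : ℝ) : ℂ)⁻¹ • modeLp k := by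
  rw [fourierHilbertBasis, HilbertBasis.coe_mkOfOrthogonalEqBot]

/-- The real `L²` function with Fourier coefficients `a` (up to taking the real part). -/
def synth : Seq →L[ℝ] L2T :=
  -- Taking the real part makes it unnecessary to carry the symmetry `a (-k) = conj (a k)` through
  -- the evolution.
  (ContinuousLinearMap.compLpL 2 torusMeasure Complex.reCLM).comp
    ((((√(2 * π) : ℝ) : ℂ) • (fourierHilbertBasis.repr.symm : Seq →L[ℂ] Lp ℂ 2 torusMeasure)
      ).restrictScalars ℝ)

theorem synth_apply (a : Seq) : synth a = ContinuousLinearMap.compLpL 2 torusMeasure Complex.reCLM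
    (((√(2 * π) : ℝ) : ℂ) • fourierHilbertBasis.repr.symm a) := rfl

theorem synth_single (k : ℤ) (z : ℂ) :
    synth (lp.single 2 k z) =ᵐ[torusMeasure] fun θ => (z * mode k θ).re := by
  have h1 : fourierHilbertBasis.repr.symm (lp.single 2 k z)
      = z • (((√(2 * π) : ℝ) : ℂ)⁻¹ • modeLp k) := by
    rw [← fourierHilbertBasis_apply, ← fourierHilbertBasis.repr_symm_single, ← map_smul,
      ← lp.single_smul, smul_eq_mul, mul_one]
  rw [synth_apply, h1, smul_comm z, smul_inv_smul₀ ofReal_sqrt_two_pi_ne_zero]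
  filter_upwards [ContinuousLinearMap.coeFn_compLpL (p := 2) (μ := torusMeasure) Complex.reCLM
    (z • modeLp k), Lp.coeFn_smul z (modeLp k), coeFn_modeLp k] with θ h1 h2 h3
  rw [h1, h2, Pi.smul_apply, h3, smul_eq_mul, Complex.reCLM_apply]

theorem hasSum_synth (a : Seq) : HasSum (fun k => synth (lp.single 2 k (a k))) (synth a) :=
  (lp.hasSum_single (by norm_num) a).mapL synth

/-- Absolute summability gives convergence in the sup norm, and the inclusion of bounded continuous
functions in `L²` identifies the two sums. -/
theorem synth_ae_eq_trigSeries {a : Seq} (ha : Summable fun k => ‖a k‖) :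
    synth a =ᵐ[torusMeasure] trigSeries a := by
  set g : ℤ → BoundedContinuousFunction ℝ ℝ := fun k =>
    BoundedContinuousFunction.ofNormedAddCommGroup (fun θ => (a k * mode k θ).re)
      (by have := continuous_mode k; fun_prop) ‖a k‖ fun θ => abs_re_mul_mode_le _ k θ with hg
  have hs : Summable g := Summable.of_norm_bounded ha fun k =>
    BoundedContinuousFunction.norm_ofNormedAddCommGroup_le _ (norm_nonneg _) _
  obtain ⟨G, hG⟩ := hs
  have hGe (θ : ℝ) : G θ = trigSeries a θ :=
    (hG.mapL (BoundedContinuousFunction.evalCLM ℝ θ)).unique (hasSum_trigSeries ha θ)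
  have h1 := hG.mapL (BoundedContinuousFunction.toLp (E := ℝ) 2 torusMeasure ℝ)
  have h2 (k : ℤ) : BoundedContinuousFunction.toLp (E := ℝ) 2 torusMeasure ℝ (g k)
      = synth (lp.single 2 k (a k)) := by
    refine Lp.ext ((BoundedContinuousFunction.coeFn_toLp 2 torusMeasure ℝ (g k)).trans ?_)
    exact (synth_single k (a k)).symm
  simp only [h2] at h1
  rw [← h1.unique (hasSum_synth a)]
  refine (BoundedContinuousFunction.coeFn_toLp 2 torusMeasure ℝ G).trans (Eventually.of_forall hGe)

theorem memLp_of_continuous {E : Type*} [NormedAddCommGroup E] {f : ℝ → E}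
    (hf : Continuous f) : MemLp f 2 torusMeasure := by
  obtain ⟨C, hC⟩ := (isCompact_Icc (a := -π) (b := π)).exists_bound_of_continuousOn hf.continuousOn
  refine MemLp.of_bound hf.aestronglyMeasurable C ?_
  filter_upwards [ae_restrict_mem measurableSet_Ioc] with θ hθ using hC θ (Ioc_subset_Icc_self hθ)

/-- Integration against a continuous function as a continuous functional on `L²`. -/
theorem exists_integral_functional {ψ : ℝ → ℝ} (hψ : Continuous ψ) :
    ∃ Λ : L2T →L[ℝ] ℝ, ∀ f : L2T, Λ f = ∫ θ in (-π)..π, f θ * ψ θ := by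
  refine ⟨innerSL ℝ ((memLp_of_continuous hψ).toLp ψ), fun f => ?_⟩
  rw [innerSL_apply_apply, L2.inner_def, intervalIntegral.integral_of_le neg_pi_le_pi]
  refine MeasureTheory.integral_congr_ae ?_
  filter_upwards [(memLp_of_continuous hψ).coeFn_toLp] with θ hθ
  rw [hθ]
  simp

theorem hasDerivAt_re_mul_mode (z : ℂ) (k : ℤ) (θ : ℝ) :
    HasDerivAt (fun θ => (z * mode k θ).re) (Complex.I * k * z * mode k θ).re θ := by
  have h2 := Complex.reCLM.hasFDerivAt.comp_hasDerivAt θ ((hasDerivAt_mode k θ).const_mul z)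
  convert! h2 using 1
  simp only [Complex.reCLM_apply]
  ring_nf

/-- Integration against a fixed test function is continuous on `L²`, so the claim reduces to
classical integration by parts for one mode. -/
theorem isWeakDeriv_synth {a b : Seq} (h : ∀ k, b k = Complex.I * k * a k) :
    IsWeakDeriv (synth a) (synth b) := by
  intro φ hφ hper
  obtain ⟨Λ, hΛ⟩ := exists_integral_functional hφ.continuous
  obtain ⟨Λ', hΛ'⟩ := exists_integral_functional (hφ.continuous_deriv (by simp))
  rw [← hΛ, ← hΛ']
  have h1 := (hasSum_synth a).mapL Λ'
  have h2 := ((hasSum_synth b).mapL Λ).neg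
  refine h1.unique ?_
  convert! h2 using 2 with k
  rw [hΛ, hΛ', L2T.integral_congr (synth_single k (a k)), L2T.integral_congr (synth_single k (b k)),
    h k]
  have hm := continuous_mode k
  have hpi := hper (-π)
  have hmi := mode_periodic k (-π)
  rw [show -π + 2 * π = π by ring] at hpi hmi
  rw [intervalIntegral.integral_mul_deriv_eq_deriv_mul
    (fun θ _ => hasDerivAt_re_mul_mode (a k) k θ)
    (fun θ _ => (hφ.differentiable (by simp) θ).hasDerivAt)
    (Continuous.intervalIntegrable (by fun_prop) _ _)
    ((hφ.continuous_deriv (by simp)).intervalIntegrable _ _), hpi, hmi]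
  ring

theorem abs_pow_div_rho_pow_le {j s : ℕ} (h : j ≤ s) (k : ℤ) :
    |(k : ℝ) ^ j / rho k ^ s| ≤ 1 := by
  rw [abs_div, abs_pow, abs_of_nonneg (pow_nonneg (rho_pos k).le s),
    div_le_one (pow_pos (rho_pos k) s)]
  calc |(k : ℝ)| ^ j ≤ rho k ^ j := by gcongr; exact abs_le_rho k
    _ ≤ rho k ^ s := pow_le_pow_right₀ (one_le_rho k) h

/-- The Fourier multiplier `(ik)^j (1 + |k|)^{-s}`. -/
def derivMult (s : ℕ) (j : Fin (s + 1)) : Seq →L[ℂ] Seq :=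
  Complex.I ^ (j : ℕ) • wshift (fun k => (k : ℝ) ^ (j : ℕ) / rho k ^ s) 0
    ⟨1, abs_pow_div_rho_pow_le (Nat.lt_succ_iff.1 j.2)⟩

theorem derivMult_apply (s : ℕ) (j : Fin (s + 1)) (y : Seq) (k : ℤ) :
    derivMult s j y k = (Complex.I * k) ^ (j : ℕ) * wt s y k := by
  have h : derivMult s j y k
    = Complex.I ^ (j : ℕ) * (((k : ℝ) ^ (j : ℕ) / rho k ^ s : ℝ) * y (k + 0)) := rfl
  rw [h, wt_apply, add_zero, mul_pow]
  push_cast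
  ring

/-- The Sobolev function with Fourier coefficients `(1 + |k|)^{-s} y_k`. -/
def toSobolev (s : ℕ) : Seq →L[ℝ] Sobolev s :=
  (((PiLp.continuousLinearEquiv 2 ℝ (fun _ : Fin (s + 1) => L2T)).symm :
      (Fin (s + 1) → L2T) →L[ℝ] PiLp 2 (fun _ : Fin (s + 1) => L2T)).comp
    (ContinuousLinearMap.pi fun j => synth.comp ((derivMult s j).restrictScalars ℝ))).codRestrict
      (sobolevSubmodule s) (fun y k => isWeakDeriv_synth fun i => by
        change derivMult s k.succ y i = Complex.I * i * derivMult s k.castSucc y i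
        rw [derivMult_apply, derivMult_apply, Fin.val_succ, Fin.val_castSucc]
        ring)

theorem toSobolev_toFun {s : ℕ} {y : Seq} (h : Summable fun k => ‖wt s y k‖) :
    (toSobolev s y).toFun =ᵐ[torusMeasure] trigSeries (wt s y) := by
  have e : (toSobolev s y).toFun = (synth (derivMult s 0 y) : ℝ → ℝ) := rfl
  have e2 : derivMult s 0 y = wt s y := by
    ext k
    simp [derivMult_apply]
  rw [e, e2]
  exact synth_ae_eq_trigSeries h

/-- The Fourier coefficients of a real `L²` function. -/
def coeffSeq (f : L2T) : Seq := ((√(2 * π) : ℝ) : ℂ)⁻¹ •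
  fourierHilbertBasis.repr (ContinuousLinearMap.compLpL 2 torusMeasure Complex.ofRealCLM f)

theorem synth_coeffSeq (f : L2T) : synth (coeffSeq f) = f := by
  rw [synth_apply, coeffSeq, LinearIsometryEquiv.map_smul, LinearIsometryEquiv.symm_apply_apply,
    smul_inv_smul₀ ofReal_sqrt_two_pi_ne_zero]
  refine Lp.ext ?_
  set g := ContinuousLinearMap.compLpL 2 torusMeasure Complex.ofRealCLM f with hg
  filter_upwards [ContinuousLinearMap.coeFn_compLpL (p := 2) (μ := torusMeasure) Complex.reCLM g,
    ContinuousLinearMap.coeFn_compLpL (p := 2) (μ := torusMeasure) Complex.ofRealCLM f]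
    with θ h1 h2
  rw [h1, hg, h2]
  simp

theorem coeffSeq_apply (f : L2T) (k : ℤ) : coeffSeq f k = coeff (fun θ => (f θ : ℂ)) k := by
  set g := ContinuousLinearMap.compLpL 2 torusMeasure Complex.ofRealCLM f with hg
  have h1 : coeffSeq f k = ((√(2 * π) : ℝ) : ℂ)⁻¹ * fourierHilbertBasis.repr g k := rfl
  have h2 : (g : ℝ → ℂ) =ᵐ[torusMeasure] fun θ => (f θ : ℂ) :=
    ContinuousLinearMap.coeFn_compLpL (p := 2) (μ := torusMeasure) Complex.ofRealCLM f
  rw [h1, HilbertBasis.repr_apply_apply, fourierHilbertBasis_apply, inner_smul_left, inner_modeLp,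
    coeff_congr h2, map_inv₀, Complex.conj_ofReal, ← ofReal_sqrt_two_pi_mul_self]
  have := ofReal_sqrt_two_pi_ne_zero
  field_simp

theorem coeff_ofReal_eq {f : ℝ → ℝ} (hf : IntervalIntegrable f volume (-π) π) (k : ℤ) :
    coeff (fun θ => (f θ : ℂ)) k = 1 / (2 * π) * ((∫ θ in (-π)..π, f θ * Real.cos (k * θ) : ℝ)
      - Complex.I * (∫ θ in (-π)..π, f θ * Real.sin (k * θ) : ℝ)) := by
  have i1 : IntervalIntegrable (fun θ => f θ * Real.cos (k * θ)) volume (-π) π :=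
    hf.mul_continuousOn (by fun_prop)
  have i2 : IntervalIntegrable (fun θ => f θ * Real.sin (k * θ)) volume (-π) π :=
    hf.mul_continuousOn (by fun_prop)
  have j1 : IntervalIntegrable (fun θ => ((f θ * Real.cos (k * θ) : ℝ) : ℂ)) volume (-π) π :=
    ⟨Integrable.ofReal i1.1, Integrable.ofReal i1.2⟩
  have j2 : IntervalIntegrable (fun θ => ((f θ * Real.sin (k * θ) : ℝ) : ℂ)) volume (-π) π :=
    ⟨Integrable.ofReal i2.1, Integrable.ofReal i2.2⟩
  rw [coeff, ← intervalIntegral.integral_ofReal, ← intervalIntegral.integral_ofReal,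
    ← intervalIntegral.integral_const_mul Complex.I,
    ← intervalIntegral.integral_sub j1 (j2.const_mul _)]
  congr 1
  refine intervalIntegral.integral_congr fun θ _ => ?_
  simp only [mode_eq_cos_add]
  push_cast
  rw [neg_mul, Complex.cos_neg, Complex.sin_neg]
  ring

/-- Test functions are real, so the character is tested through `cos(kθ)` and `sin(kθ)`, each of
which gives half of the complex identity. -/
theorem coeffSeq_of_isWeakDeriv {f g : L2T} (h : IsWeakDeriv f g) (k : ℤ) :
    coeffSeq g k = Complex.I * k * coeffSeq f k := by
  rw [coeffSeq_apply, coeffSeq_apply, coeff_ofReal_eq (L2T.intervalIntegrable f),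
    coeff_ofReal_eq (L2T.intervalIntegrable g)]
  have hlin (θ : ℝ) : HasDerivAt (fun θ : ℝ => (k : ℝ) * θ) k θ := by
    simpa using (hasDerivAt_id θ).const_mul (k : ℝ)
  have dc : deriv (fun θ : ℝ => Real.cos (k * θ)) = fun θ => -k * Real.sin (k * θ) := by
    funext θ
    rw [(hlin θ).cos.deriv]
    ring
  have ds : deriv (fun θ : ℝ => Real.sin (k * θ)) = fun θ => k * Real.cos (k * θ) := by
    funext θ
    rw [(hlin θ).sin.deriv]
    ring
  have hc := h (fun θ => Real.cos (k * θ)) (by fun_prop) (fun θ => by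
    simp only
    rw [mul_add, ← Real.cos_add_int_mul_two_pi (k * θ) k])
  have hs := h (fun θ => Real.sin (k * θ)) (by fun_prop) (fun θ => by
    simp only
    rw [mul_add, ← Real.sin_add_int_mul_two_pi (k * θ) k])
  have ec : ∫ θ in (-π)..π, f θ * (-k * Real.sin (k * θ))
      = -k * ∫ θ in (-π)..π, f θ * Real.sin (k * θ) := by
    rw [← intervalIntegral.integral_const_mul]
    congr 1
    funext θ
    ring
  have es : ∫ θ in (-π)..π, f θ * (k * Real.cos (k * θ))
      = k * ∫ θ in (-π)..π, f θ * Real.cos (k * θ) := by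
    rw [← intervalIntegral.integral_const_mul]
    congr 1
    funext θ
    ring
  simp only [dc, ec] at hc
  simp only [ds, es] at hs
  have hc' : ∫ θ in (-π)..π, g θ * Real.cos (k * θ)
      = k * ∫ θ in (-π)..π, f θ * Real.sin (k * θ) := by linarith
  have hs' : ∫ θ in (-π)..π, g θ * Real.sin (k * θ)
      = -(k * ∫ θ in (-π)..π, f θ * Real.cos (k * θ)) := by linarith
  rw [hc', hs']
  push_cast
  linear_combination (1 / (2 * π) * (k : ℂ) *
    ((∫ θ in (-π)..π, f θ * Real.sin (k * θ) : ℝ) : ℂ)) * Complex.I_sq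

theorem coeffSeq_sobolev {m : ℕ} (f : Sobolev m) (k : ℤ) (j : Fin (m + 1)) :
    coeffSeq (f.1 j) k = (Complex.I * k) ^ (j : ℕ) * coeffSeq (f.1 0) k := by
  induction j using Fin.induction with
  | zero => simp
  | succ j ih =>
    rw [coeffSeq_of_isWeakDeriv (f.2 j), ih, Fin.val_succ, Fin.val_castSucc]
    ring

/-- Since `(1 + |k|)^m ≤ 2^m (1 + |k|^m)`, square summability of the coefficients of `f` and of its
top derivative is enough. -/
theorem exists_wt_eq_coeffSeq {m : ℕ} (f : Sobolev m) : ∃ y : Seq, wt m y = coeffSeq (f.1 0) := by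
  have hmem : Memℓp (fun k => (rho k : ℂ) ^ m * coeffSeq (f.1 0) k) 2 := by
    rw [memℓp_two_iff]
    refine (((coeffSeq (f.1 0)).summable_sq.add
      (coeffSeq (f.1 (Fin.last m))).summable_sq).mul_left (2 * (2 ^ m) ^ 2)).of_nonneg_of_le
        (fun k => by positivity) fun k => ?_
    rw [coeffSeq_sobolev f k (Fin.last m), norm_mul, norm_mul, norm_pow, norm_pow,
      norm_I_mul_int, Complex.norm_real, Real.norm_eq_abs, abs_of_pos (rho_pos k), Fin.val_last]
    have h1 : rho k ^ m ≤ 2 ^ m * (1 + |(k : ℝ)| ^ m) := by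
      refine (add_pow_le zero_le_one (abs_nonneg (k : ℝ)) m).trans ?_
      rw [one_pow]
      gcongr
      · norm_num
      · exact Nat.sub_le _ _
    set a := ‖coeffSeq (f.1 0) k‖
    set b := |(k : ℝ)| ^ m * a
    have h2 : rho k ^ m * a ≤ 2 ^ m * (a + b) := by
      calc _ ≤ 2 ^ m * (1 + |(k : ℝ)| ^ m) * a := by gcongr
        _ = _ := by ring
    have h3 : 0 ≤ rho k ^ m * a := mul_nonneg (pow_nonneg (rho_pos k).le m) (norm_nonneg _)
    calc (rho k ^ m * a) ^ 2 ≤ (2 ^ m * (a + b)) ^ 2 := by gcongr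
      _ = (2 ^ m) ^ 2 * (a + b) ^ 2 := by ring
      _ ≤ (2 ^ m) ^ 2 * (2 * (a ^ 2 + b ^ 2)) := by
          gcongr
          nlinarith [sq_nonneg (a - b)]
      _ = _ := by ring
  refine ⟨⟨_, hmem⟩, ?_⟩
  ext k
  rw [wt_apply]
  exact inv_mul_cancel_left₀ (pow_ne_zero _ (ofReal_rho_ne_zero k)) _

end FourierBasis

/-! ### The `L²` energy estimate for classical solutions. -/

section Uniqueness

theorem exists_lipschitz_of_contDiff_periodic {f : ℝ → ℝ} (hf : ContDiff ℝ 1 f)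
    (hp : Function.Periodic f (2 * π)) : ∃ M, ∀ a b, |f a - f b| ≤ M * |a - b| := by
  have hd : Function.Periodic (deriv f) (2 * π) := by
    intro θ
    rw [← deriv_comp_add_const]
    exact congrArg (fun g => deriv g θ) (funext hp)
  obtain ⟨C, hC⟩ := (hd.isBounded_of_continuous (by positivity)
    (hf.continuous_deriv le_rfl)).exists_norm_le
  refine ⟨C, fun a b => convex_univ.norm_image_sub_le_of_norm_deriv_le (f := f)
    (fun θ _ => hf.differentiable one_ne_zero θ) (fun θ _ => hC _ ⟨θ, rfl⟩) (mem_univ b)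
    (mem_univ a)⟩

theorem continuous_hilbertInt {w : ℝ → ℝ} {M : ℝ} (hw : ∀ a b, |w a - w b| ≤ M * |a - b|) :
    Continuous (hilbertInt w) := by
  have hc := continuous_of_lipschitz hw
  refine continuous_const.mul (intervalIntegral.continuous_of_dominated_interval
    (bound := fun _ => π * (2 * M)) (fun θ => ?_) (fun θ => ?_) intervalIntegrable_const ?_)
  · exact (measurable_cot_half.mul (by fun_prop)).aestronglyMeasurable
  · refine Eventually.of_forall fun s hs => ?_
    rw [uIoc_of_le pi_pos.le] at hs
    exact abs_cot_half_mul_le (g := fun s => w (θ - s) - w (θ + s))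
      (abs_sub_symm_le hw θ s hs.1.le) hs.1 hs.2
  · exact Eventually.of_forall fun s _ => by fun_prop

theorem mode_mul_mode_neg (k : ℤ) (θ : ℝ) : mode k θ * mode (-k) θ = 1 := by
  rw [← mode_add, add_neg_cancel, mode_zero_left]

theorem integral_periodic_shift {g : ℝ → ℂ} (hg : Function.Periodic g (2 * π)) (s : ℝ) :
    ∫ θ in (-π)..π, g (θ + s) = ∫ θ in (-π)..π, g θ := by
  rw [intervalIntegral.integral_comp_add_right]
  have := hg.intervalIntegral_add_eq (-π + s) (-π)
  rwa [show -π + s + 2 * π = π + s by ring, show -π + 2 * π = π by ring] at this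

theorem integral_mode_mul_shift {w : ℝ → ℝ} (hp : Function.Periodic w (2 * π)) (k : ℤ) (s : ℝ) :
    ∫ θ in (-π)..π, mode (-k) θ * (w (θ + s) : ℂ)
      = mode k s * ∫ θ in (-π)..π, mode (-k) θ * (w θ : ℂ) := by
  have hper : Function.Periodic (fun θ => mode (-k) θ * (w θ : ℂ)) (2 * π) := by
    intro θ
    simp only [mode_periodic (-k) θ, hp θ]
  rw [← integral_periodic_shift hper s, ← intervalIntegral.integral_const_mul]
  refine intervalIntegral.integral_congr fun θ _ => ?_
  simp only [mode_add_arg]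
  linear_combination (-mode (-k) θ * (w (θ + s) : ℂ)) * mode_mul_mode_neg k s

/-- A `C¹` function need not satisfy the summability used for trigonometric series, so the
multiplier is computed by Fubini: the folded integrand is bounded, and translating `w` by `±s`
multiplies its coefficient by `e^{±iks}`. -/
theorem coeff_hilbertInt {w : ℝ → ℝ} {M : ℝ} (hw : ∀ a b, |w a - w b| ≤ M * |a - b|)
    (hp : Function.Periodic w (2 * π)) (k : ℤ) :
    coeff (fun θ => (hilbertInt w θ : ℂ)) k
      = -Complex.I * ((SignType.sign k : ℝ) : ℂ) * coeff (fun θ => (w θ : ℂ)) k := by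
  have hc := continuous_of_lipschitz hw
  have hm := continuous_mode (-k)
  set c := ∫ θ in (-π)..π, mode (-k) θ * (w θ : ℂ) with hcdef
  set f : ℝ → ℝ → ℂ := fun θ s =>
    mode (-k) θ * ((Real.cot (s / 2) * (w (θ - s) - w (θ + s)) : ℝ) : ℂ) with hf
  have hmeas : Measurable (Function.uncurry f) := by
    have h1 : Measurable fun p : ℝ × ℝ => mode (-k) p.1 := (hm.comp continuous_fst).measurable
    have h2 : Measurable fun p : ℝ × ℝ => Real.cot (p.2 / 2) :=
      measurable_cot_half.comp measurable_snd
    have h3 : Measurable fun p : ℝ × ℝ => w (p.1 - p.2) - w (p.1 + p.2) :=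
      Continuous.measurable (by fun_prop)
    exact h1.mul (Complex.measurable_ofReal.comp (h2.mul h3))
  have hint : Integrable (Function.uncurry f)
      ((volume.restrict (Ioc (-π) π)).prod (volume.restrict (Ioc 0 π))) := by
    refine Integrable.of_bound hmeas.aestronglyMeasurable (π * (2 * M)) ?_
    rw [Measure.prod_restrict]
    filter_upwards [ae_restrict_mem (measurableSet_Ioc.prod measurableSet_Ioc)] with p hp
    rw [Function.uncurry_def, hf]
    simp only
    rw [norm_mul, norm_mode, one_mul, Complex.norm_real]
    exact abs_cot_half_mul_le (g := fun s => w (p.1 - s) - w (p.1 + s))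
      (abs_sub_symm_le hw p.1 p.2 hp.2.1.le) hp.2.1 hp.2.2
  have swap := integral_integral_swap hint
  have e1 (θ : ℝ) : mode (-k) θ * (hilbertInt w θ : ℂ)
      = 1 / (2 * π) * ∫ s in Ioc 0 π, f θ s := by
    rw [hilbertInt, hf]
    simp only
    rw [MeasureTheory.integral_const_mul, integral_complex_ofReal,
      intervalIntegral.integral_of_le pi_pos.le]
    push_cast
    ring
  have e2 (s : ℝ) : ∫ θ in Ioc (-π) π, f θ s
      = (-2 * Complex.I * c) * ((Real.cot (s / 2) * Real.sin (k * s) : ℝ) : ℂ) := by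
    rw [← intervalIntegral.integral_of_le neg_pi_le_pi]
    have h1 (θ : ℝ) : f θ s = (Real.cot (s / 2) : ℂ) * (mode (-k) θ * (w (θ + -s) : ℂ))
        - (Real.cot (s / 2) : ℂ) * (mode (-k) θ * (w (θ + s) : ℂ)) := by
      rw [hf, ← sub_eq_add_neg]
      push_cast
      ring
    simp only [h1]
    rw [intervalIntegral.integral_sub (Continuous.intervalIntegrable (by fun_prop) _ _)
      (Continuous.intervalIntegrable (by fun_prop) _ _), intervalIntegral.integral_const_mul,
      intervalIntegral.integral_const_mul, integral_mode_mul_shift hp, integral_mode_mul_shift hp,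
      mode_eq_cos_add, mode_eq_cos_add, mul_neg, Real.cos_neg, Real.sin_neg]
    push_cast
    ring
  rw [coeff, coeff, intervalIntegral.integral_of_le neg_pi_le_pi]
  simp only [e1]
  rw [MeasureTheory.integral_const_mul, swap]
  simp only [e2]
  rw [MeasureTheory.integral_const_mul, integral_complex_ofReal,
    ← intervalIntegral.integral_of_le pi_pos.le,
    integral_cot_half_mul_sin]
  have hpi : (π : ℂ) ≠ 0 := by exact_mod_cast pi_ne_zero
  rw [← hcdef]
  push_cast
  field_simp

theorem integral_hilbertInt_sq_le {w : ℝ → ℝ} {M : ℝ} (hw : ∀ a b, |w a - w b| ≤ M * |a - b|)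
    (hp : Function.Periodic w (2 * π)) :
    ∫ θ in (-π)..π, hilbertInt w θ ^ 2 ≤ ∫ θ in (-π)..π, w θ ^ 2 := by
  have h1 := hasSum_sq_coeff (memLp_of_continuous
    (Complex.continuous_ofReal.comp (continuous_hilbertInt hw)))
  have h2 := hasSum_sq_coeff (memLp_of_continuous
    (Complex.continuous_ofReal.comp (continuous_of_lipschitz hw)))
  have h3 := hasSum_le (fun k => by
    have e := coeff_hilbertInt hw hp k
    change ‖coeff (fun θ => (hilbertInt w θ : ℂ)) k‖ ^ 2 ≤ ‖coeff (fun θ => (w θ : ℂ)) k‖ ^ 2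
    rw [e, norm_mul]
    gcongr
    exact mul_le_of_le_one_left (norm_nonneg _) (norm_neg_I_mul_sign_le k)) h1 h2
  have h4 := le_of_mul_le_mul_left h3 (by positivity)
  simpa only [Function.comp_apply, Complex.norm_real, Real.norm_eq_abs, sq_abs] using h4

/-- Cauchy–Schwarz, obtained from the nonnegativity of the variance of `g`. -/
theorem sq_integral_le {g : ℝ → ℝ} (hg : Continuous g) {a b : ℝ} (hab : a < b) :
    (∫ x in a..b, g x) ^ 2 ≤ (b - a) * ∫ x in a..b, g x ^ 2 := by
  set L := b - a with hL
  have hLpos : 0 < L := by linarith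
  set I := ∫ x in a..b, g x with hI
  have h0 : 0 ≤ ∫ x in a..b, (g x - I / L) ^ 2 :=
    intervalIntegral.integral_nonneg hab.le fun x _ => sq_nonneg _
  have e (x : ℝ) : (g x - I / L) ^ 2 = g x ^ 2 - 2 * (I / L) * g x + (I / L) ^ 2 := by ring
  simp only [e] at h0
  rw [intervalIntegral.integral_add (Continuous.intervalIntegrable (by fun_prop) _ _)
    (Continuous.intervalIntegrable (by fun_prop) _ _), intervalIntegral.integral_sub
    (Continuous.intervalIntegrable (by fun_prop) _ _)
    (Continuous.intervalIntegrable (by fun_prop) _ _), intervalIntegral.integral_const_mul,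
    intervalIntegral.integral_const, ← hI, ← hL, smul_eq_mul] at h0
  have h1 : 2 * (I / L) * I - L * (I / L) ^ 2 = I ^ 2 / L := by field_simp; ring
  have h2 : I ^ 2 / L ≤ ∫ x in a..b, g x ^ 2 := by linarith
  rw [div_le_iff₀ hLpos] at h2
  linarith

/-- Because `u` vanishes at 0, `|u|` is at most the integral of `|h|` over the period. One factor
`2π` comes from Cauchy–Schwarz and the other from integrating the pointwise bound. -/
theorem integral_sq_le_of_hasDerivAt {u h : ℝ → ℝ} (hu : ∀ θ, HasDerivAt u (h θ) θ)
    (hh : Continuous h) (h0 : u 0 = 0) :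
    ∫ θ in (-π)..π, u θ ^ 2 ≤ 4 * π ^ 2 * ∫ θ in (-π)..π, h θ ^ 2 := by
  have hc : Continuous u := continuous_iff_continuousAt.2 fun θ => (hu θ).continuousAt
  set K := 2 * π * ∫ θ in (-π)..π, h θ ^ 2 with hK
  have hb (θ : ℝ) (hθ : θ ∈ Icc (-π) π) : u θ ^ 2 ≤ K := by
    have h1 := intervalIntegral.integral_eq_sub_of_hasDerivAt (a := 0) (b := θ)
      (fun x _ => hu x) (hh.intervalIntegrable _ _)
    rw [h0, sub_zero] at h1
    have h2 : |u θ| ≤ ∫ x in (-π)..π, |h x| := by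
      rw [← h1]
      refine (intervalIntegral.norm_integral_le_abs_integral_norm (f := h)).trans ?_
      rw [intervalIntegral.abs_intervalIntegral_eq, intervalIntegral.integral_of_le neg_pi_le_pi,
        abs_of_nonneg (MeasureTheory.integral_nonneg fun x => norm_nonneg _)]
      refine setIntegral_mono_set (hh.abs.integrableOn_Ioc) (Eventually.of_forall fun x =>
        abs_nonneg _) (LE.le.eventuallyLE ?_)
      rintro x ⟨hx1, hx2⟩
      refine ⟨lt_of_le_of_lt ?_ hx1, hx2.trans ?_⟩
      · exact le_min (by linarith [pi_pos]) hθ.1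
      · exact max_le pi_pos.le hθ.2
    have h3 := sq_integral_le hh.abs neg_pi_lt_pi
    simp only [sq_abs] at h3
    rw [show π - -π = 2 * π by ring] at h3
    calc u θ ^ 2 = |u θ| ^ 2 := (sq_abs _).symm
      _ ≤ (∫ x in (-π)..π, |h x|) ^ 2 := by gcongr
      _ ≤ K := h3
  have h4 := intervalIntegral.integral_mono_on (μ := volume) neg_pi_le_pi
    (Continuous.intervalIntegrable (by fun_prop) _ _) (intervalIntegrable_const (c := K)) hb
  rw [intervalIntegral.integral_const, smul_eq_mul] at h4
  rw [hK] at h4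
  linarith

/-- The `L²` energy estimate for the linearized operator. -/
theorem energy_estimate {w u : ℝ → ℝ} (hw : ContDiff ℝ 1 w) (hp : Function.Periodic w (2 * π))
    (hu : ∀ θ, HasDerivAt u (hilbertInt w θ) θ) (h0 : u 0 = 0) :
    ∫ θ in (-π)..π, 2 * w θ * -(1 / 2 * sin (2 * θ) * deriv w θ - cos (2 * θ) * w θ
      + sin (2 * θ) * hilbertInt w θ - 2 * cos (2 * θ) * u θ)
      ≤ (7 + 8 * π ^ 2) * ∫ θ in (-π)..π, w θ ^ 2 := by
  obtain ⟨M, hM⟩ := exists_lipschitz_of_contDiff_periodic hw hp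
  have hc := hw.continuous
  have hd := hw.continuous_deriv le_rfl
  have hh := continuous_hilbertInt hM
  have huc : Continuous u := continuous_iff_continuousAt.2 fun θ => (hu θ).continuousAt
  have hH := integral_hilbertInt_sq_le hM hp
  have hU := integral_sq_le_of_hasDerivAt hu hh h0
  have hUH : ∫ θ in (-π)..π, u θ ^ 2 ≤ 4 * π ^ 2 * ∫ θ in (-π)..π, w θ ^ 2 :=
    hU.trans (by gcongr)
  have parts : ∫ θ in (-π)..π, sin (2 * θ) * (2 * w θ * deriv w θ)
      = -∫ θ in (-π)..π, 2 * cos (2 * θ) * w θ ^ 2 := by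
    have h1 (θ : ℝ) : HasDerivAt (fun θ => sin (2 * θ)) (2 * cos (2 * θ)) θ := by
      have := ((hasDerivAt_id θ).const_mul 2).sin
      simp only [id] at this
      convert! this using 1
      ring
    have h2 (θ : ℝ) : HasDerivAt (fun θ => w θ ^ 2) (2 * w θ * deriv w θ) θ := by
      simpa using (hw.differentiable one_ne_zero θ).hasDerivAt.fun_pow 2
    rw [intervalIntegral.integral_mul_deriv_eq_deriv_mul (fun θ _ => h1 θ) (fun θ _ => h2 θ)
      (Continuous.intervalIntegrable (by fun_prop) _ _)
      (Continuous.intervalIntegrable (by fun_prop) _ _)]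
    simp
  -- The added terms integrate to zero by `parts` and remove `w w'` from the integrand. What remains
  -- is `3 cos w² - 2 sin w Hw + 4 cos w u` with argument `2θ`; the bounds on `Hw` and `u` turn `6 +
  -- 1 + 2 · 4π²` into the constant `7 + 8π²`.
  have key : ∫ θ in (-π)..π, (2 * w θ * -(1 / 2 * sin (2 * θ) * deriv w θ - cos (2 * θ) * w θ
      + sin (2 * θ) * hilbertInt w θ - 2 * cos (2 * θ) * u θ)
      + (1 / 2 * (sin (2 * θ) * (2 * w θ * deriv w θ)) + 1 / 2 * (2 * cos (2 * θ) * w θ ^ 2)))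
      ≤ ∫ θ in (-π)..π, (6 * w θ ^ 2 + hilbertInt w θ ^ 2 + 2 * u θ ^ 2) := by
    refine intervalIntegral.integral_mono_on neg_pi_le_pi
      (Continuous.intervalIntegrable (by fun_prop) _ _)
      (Continuous.intervalIntegrable (by fun_prop) _ _) fun θ _ => ?_
    have hs := abs_le.1 (abs_sin_le_one (2 * θ))
    have hcs := abs_le.1 (abs_cos_le_one (2 * θ))
    have a1 : -(2 * sin (2 * θ) * (w θ * hilbertInt w θ)) ≤ w θ ^ 2 + hilbertInt w θ ^ 2 := by
      nlinarith [sq_nonneg (w θ - hilbertInt w θ), sq_nonneg (w θ + hilbertInt w θ)]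
    have a2 : 4 * cos (2 * θ) * (w θ * u θ) ≤ 2 * w θ ^ 2 + 2 * u θ ^ 2 := by
      nlinarith [sq_nonneg (w θ - u θ), sq_nonneg (w θ + u θ)]
    have a3 : cos (2 * θ) * w θ ^ 2 ≤ w θ ^ 2 := mul_le_of_le_one_left (sq_nonneg _) hcs.2
    linarith
  rw [intervalIntegral.integral_add (Continuous.intervalIntegrable (by fun_prop) _ _)
    (Continuous.intervalIntegrable (by fun_prop) _ _), intervalIntegral.integral_add
    (Continuous.intervalIntegrable (by fun_prop) _ _)
    (Continuous.intervalIntegrable (by fun_prop) _ _), intervalIntegral.integral_const_mul,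
    intervalIntegral.integral_const_mul (1 / 2) (fun θ => 2 * cos (2 * θ) * w θ ^ 2), parts,
    intervalIntegral.integral_add (Continuous.intervalIntegrable (by fun_prop) _ _)
    (Continuous.intervalIntegrable (by fun_prop) _ _), intervalIntegral.integral_add
    (Continuous.intervalIntegrable (by fun_prop) _ _)
    (Continuous.intervalIntegrable (by fun_prop) _ _), intervalIntegral.integral_const_mul,
    intervalIntegral.integral_const_mul] at key
  linarith

end Uniqueness

/-! ### Gronwall's argument, uniqueness, and assembly of the solution. -/

section WellPosedness

theorem contDiff_slice {T : ℝ} {w : ℝ → ℝ → ℝ}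
    (hw : ContDiffOn ℝ 1 (fun p : ℝ × ℝ => w p.1 p.2) (Icc 0 T ×ˢ univ)) {t : ℝ}
    (ht : t ∈ Icc 0 T) : ContDiff ℝ 1 (w t) := by
  rw [← contDiffOn_univ]
  exact hw.comp (f := fun θ : ℝ => (t, θ)) (by fun_prop) fun θ _ => ⟨ht, mem_univ θ⟩

/-- This supplies the dominating constant for differentiating the energy under the integral.
One-sided derivatives are unique, so `g` is the time component of the continuous derivative of `w`,
up to the endpoints. -/
theorem exists_bound_time_deriv {T : ℝ} (hT : 0 < T) {w g : ℝ → ℝ → ℝ}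
    (hw : ContDiffOn ℝ 1 (fun p : ℝ × ℝ => w p.1 p.2) (Icc 0 T ×ˢ univ))
    (hg : ∀ t ∈ Icc 0 T, ∀ θ, HasDerivWithinAt (fun s => w s θ) (g t θ) (Icc 0 T) t) :
    ∃ B, 0 ≤ B ∧ ∀ t ∈ Icc 0 T, ∀ θ ∈ Icc (-π) π, |w t θ| ≤ B ∧ |g t θ| ≤ B := by
  set S : Set (ℝ × ℝ) := Icc 0 T ×ˢ univ with hS
  have hSu : UniqueDiffOn ℝ S := (uniqueDiffOn_Icc hT).prod uniqueDiffOn_univ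
  have hK : IsCompact (Icc 0 T ×ˢ Icc (-π) π) := isCompact_Icc.prod isCompact_Icc
  have hsub : Icc 0 T ×ˢ Icc (-π) π ⊆ S := prod_mono_right (subset_univ _)
  obtain ⟨B₁, hB₁⟩ := hK.exists_bound_of_continuousOn (hw.continuousOn.mono hsub)
  obtain ⟨B₂, hB₂⟩ := hK.exists_bound_of_continuousOn
    ((hw.continuousOn_fderivWithin hSu le_rfl).mono hsub)
  refine ⟨max (max B₁ B₂) 0, le_max_right _ _, fun t ht θ hθ =>
    ⟨(hB₁ (t, θ) ⟨ht, hθ⟩).trans ((le_max_left _ _).trans (le_max_left _ _)), ?_⟩⟩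
  have h1 := (hw.differentiableOn one_ne_zero (t, θ) ⟨ht, mem_univ θ⟩).hasFDerivWithinAt
  have h2 : HasDerivWithinAt (fun s : ℝ => (s, θ)) ((1 : ℝ), (0 : ℝ)) (Icc 0 T) t :=
    ((hasDerivAt_id t).prodMk (hasDerivAt_const t θ)).hasDerivWithinAt
  have hmaps : MapsTo (fun s : ℝ => (s, θ)) (Icc 0 T) S := fun s hs => ⟨hs, mem_univ θ⟩
  have h3 := h1.comp_hasDerivWithinAt t h2 hmaps
  have h4 := (uniqueDiffOn_Icc hT t ht).eq_deriv _ (hg t ht θ) h3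
  rw [h4]
  refine ((fderivWithin ℝ (fun p : ℝ × ℝ => w p.1 p.2) S (t, θ)).le_opNorm _).trans ?_
  have h5 : ‖((1 : ℝ), (0 : ℝ))‖ = 1 := by simp [Prod.norm_def]
  rw [h5, mul_one]
  exact (hB₂ (t, θ) ⟨ht, hθ⟩).trans ((le_max_right _ _).trans (le_max_left _ _))

theorem eq_zero_of_integral_sq_nonpos {f : ℝ → ℝ} (hf : Continuous f)
    (hp : Function.Periodic f (2 * π)) (h : ∫ θ in (-π)..π, f θ ^ 2 ≤ 0) (θ : ℝ) : f θ = 0 := by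
  by_contra hne
  obtain ⟨θ', hθ', e⟩ := hp.exists_mem_Ico (by positivity : 0 < 2 * π) θ (-π)
  rw [e] at hne
  rw [show -π + 2 * π = π by ring] at hθ'
  have := intervalIntegral.integral_pos neg_pi_lt_pi (f := fun θ => f θ ^ 2)
    (by fun_prop) (fun x _ => sq_nonneg _) ⟨θ', Ico_subset_Icc_self hθ', by positivity⟩
  linarith

theorem eq_zero_of_homogeneous {T : ℝ} (hT : 0 < T) {w u : ℝ → ℝ → ℝ}
    (hper : ∀ t ∈ Icc 0 T, Function.Periodic (w t) (2 * π))
    (hw : ContDiffOn ℝ 1 (fun p : ℝ × ℝ => w p.1 p.2) (Icc 0 T ×ˢ univ))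
    (hev : ∀ t ∈ Icc 0 T, ∀ θ, HasDerivWithinAt (fun s => w s θ)
      (-(1 / 2 * sin (2 * θ) * deriv (w t) θ - cos (2 * θ) * w t θ
        + sin (2 * θ) * hilbertInt (w t) θ - 2 * cos (2 * θ) * u t θ)) (Icc 0 T) t)
    (hu : ∀ t ∈ Icc 0 T, ∀ θ, HasDerivAt (u t) (hilbertInt (w t) θ) θ)
    (hu0 : ∀ t ∈ Icc 0 T, u t 0 = 0) (h0 : w 0 =ᵐ[torusMeasure] 0) :
    ∀ t ∈ Icc 0 T, ∀ θ, w t θ = 0 := by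
  set g : ℝ → ℝ → ℝ := fun t θ => -(1 / 2 * sin (2 * θ) * deriv (w t) θ - cos (2 * θ) * w t θ
    + sin (2 * θ) * hilbertInt (w t) θ - 2 * cos (2 * θ) * u t θ) with hg
  obtain ⟨B, hB0, hB⟩ := exists_bound_time_deriv hT hw hev
  set E : ℝ → ℝ := fun t => ∫ θ in (-π)..π, w t θ ^ 2 with hE
  set C : ℝ := 7 + 8 * π ^ 2
  have hIoc {θ : ℝ} (hθ : θ ∈ uIoc (-π) π) : θ ∈ Icc (-π) π := by
    rw [uIoc_of_le neg_pi_le_pi] at hθ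
    exact Ioc_subset_Icc_self hθ
  have hcont {t : ℝ} (ht : t ∈ Icc 0 T) : Continuous (w t) := (contDiff_slice hw ht).continuous
  have hEc : ContinuousOn E (Icc 0 T) := by
    intro t ht
    refine intervalIntegral.continuousWithinAt_of_dominated_interval (bound := fun _ => B ^ 2)
      ?_ ?_ intervalIntegrable_const ?_
    · filter_upwards [self_mem_nhdsWithin] with x hx
      exact ((hcont hx).pow 2).aestronglyMeasurable
    · filter_upwards [self_mem_nhdsWithin] with x hx
      refine Eventually.of_forall fun θ hθ => ?_
      rw [norm_pow]
      exact pow_le_pow_left₀ (norm_nonneg _) (hB x hx θ (hIoc hθ)).1 2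
    · exact Eventually.of_forall fun θ _ => (hev t ht θ).continuousWithinAt.pow 2
  -- Two-sided derivatives exist only at interior times; with continuity on the closed interval this
  -- suffices for the monotonicity of `E t * exp (-C * t)`.
  have hEd (t : ℝ) (ht : t ∈ Ioo 0 T) :
      HasDerivAt E (∫ θ in (-π)..π, 2 * w t θ * g t θ) t := by
    have ht' := Ioo_subset_Icc_self ht
    obtain ⟨M, hM⟩ := exists_lipschitz_of_contDiff_periodic (contDiff_slice hw ht') (hper t ht')
    have c1 := (contDiff_slice hw ht').continuous_deriv le_rfl
    have c2 := continuous_hilbertInt hM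
    have c3 : Continuous (u t) := continuous_iff_continuousAt.2 fun θ => (hu t ht' θ).continuousAt
    have c4 := hcont ht'
    refine (intervalIntegral.hasDerivAt_integral_of_dominated_loc_of_deriv_le (s := Ioo 0 T)
      (F := fun t θ => w t θ ^ 2) (F' := fun t θ => 2 * w t θ * g t θ)
      (bound := fun _ => 2 * B * B) (Ioo_mem_nhds ht.1 ht.2) ?_ ?_ ?_ ?_ intervalIntegrable_const
      ?_).2
    · filter_upwards [Ioo_mem_nhds ht.1 ht.2] with x hx
      exact ((hcont (Ioo_subset_Icc_self hx)).pow 2).aestronglyMeasurable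
    · exact Continuous.intervalIntegrable (by fun_prop) _ _
    · exact Continuous.aestronglyMeasurable (by rw [hg]; fun_prop)
    · refine Eventually.of_forall fun θ hθ x hx => ?_
      obtain ⟨b1, b2⟩ := hB x (Ioo_subset_Icc_self hx) θ (hIoc hθ)
      rw [Real.norm_eq_abs, abs_mul, abs_mul, abs_two]
      gcongr
    · refine Eventually.of_forall fun θ _ x hx => ?_
      have := ((hev x (Ioo_subset_Icc_self hx) θ).hasDerivAt (Icc_mem_nhds hx.1 hx.2)).fun_pow 2
      convert! this using 1
      simp [hg]
  have hd (t : ℝ) (ht : t ∈ Ioo 0 T) : HasDerivAt (fun t => E t * Real.exp (-C * t))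
      ((∫ θ in (-π)..π, 2 * w t θ * g t θ) * Real.exp (-C * t)
        + E t * (Real.exp (-C * t) * -C)) t :=
    (hEd t ht).mul (by simpa using ((hasDerivAt_id t).const_mul (-C)).exp)
  have anti : AntitoneOn (fun t => E t * Real.exp (-C * t)) (Icc 0 T) := by
    refine antitoneOn_of_deriv_nonpos (convex_Icc 0 T) (hEc.mul (by fun_prop)) ?_ ?_
    · rw [interior_Icc]
      exact fun t ht => (hd t ht).differentiableAt.differentiableWithinAt
    · rw [interior_Icc]
      intro t ht
      have ht' := Ioo_subset_Icc_self ht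
      rw [(hd t ht).deriv]
      have h1 := energy_estimate (contDiff_slice hw ht') (hper t ht') (hu t ht') (hu0 t ht')
      have h2 := mul_nonpos_of_nonpos_of_nonneg (sub_nonpos.2 h1) (Real.exp_pos (-C * t)).le
      linarith
  have hE0 : E 0 = 0 := by
    rw [hE]
    simp only
    rw [intervalIntegral.integral_of_le neg_pi_le_pi]
    refine integral_eq_zero_of_ae ?_
    filter_upwards [h0] with θ hθ
    simp [hθ]
  intro t ht θ
  refine eq_zero_of_integral_sq_nonpos (hcont ht) (hper t ht) ?_ θ
  have h1 := anti ⟨le_rfl, hT.le⟩ ht ht.1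
  simp only [hE0, zero_mul] at h1
  exact nonpos_of_mul_nonpos_left h1 (Real.exp_pos _)

theorem hilbertInt_sub {f g : ℝ → ℝ} {M N : ℝ} (hf : ∀ a b, |f a - f b| ≤ M * |a - b|)
    (hg : ∀ a b, |g a - g b| ≤ N * |a - b|) (θ : ℝ) :
    hilbertInt (fun θ => f θ - g θ) θ = hilbertInt f θ - hilbertInt g θ := by
  rw [hilbertInt, hilbertInt, hilbertInt, ← mul_sub, ← intervalIntegral.integral_sub
    (intervalIntegrable_hilbertInt hf θ) (intervalIntegrable_hilbertInt hg θ)]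
  congr 2
  funext s
  ring

theorem IsClassicalSolution.unique {m : ℕ} {T : ℝ} (hT : 0 < T) {η₀ : Sobolev m}
    {η v η' v' : ℝ → ℝ → ℝ} (h : IsClassicalSolution T η₀ η v)
    (h' : IsClassicalSolution T η₀ η' v') :
    ∀ t ∈ Icc 0 T, ∀ θ, η' t θ = η t θ ∧ v' t θ = v t θ := by
  have hH (t : ℝ) (ht : t ∈ Icc 0 T) (θ : ℝ) :
      hilbertInt (fun θ => η' t θ - η t θ) θ = hilbert (η' t) θ - hilbert (η t) θ := by
    obtain ⟨M, hM⟩ := exists_lipschitz_of_contDiff_periodic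
      (contDiff_slice h.contDiffOn_eta ht) (h.periodic_eta t ht)
    obtain ⟨M', hM'⟩ := exists_lipschitz_of_contDiff_periodic
      (contDiff_slice h'.contDiffOn_eta ht) (h'.periodic_eta t ht)
    rw [hilbertInt_sub hM' hM, hilbert_eq_hilbertInt hM, hilbert_eq_hilbertInt hM']
  have hv (t : ℝ) (ht : t ∈ Icc 0 T) (θ : ℝ) : HasDerivAt (fun θ => v' t θ - v t θ)
      (hilbertInt (fun θ => η' t θ - η t θ) θ) θ := by
    rw [hH t ht θ]
    exact (h'.deriv_v t ht θ).sub (h.deriv_v t ht θ)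
  have hη := eq_zero_of_homogeneous hT (w := fun t θ => η' t θ - η t θ)
    (u := fun t θ => v' t θ - v t θ)
    (fun t ht => (h'.periodic_eta t ht).sub (h.periodic_eta t ht))
    (h'.contDiffOn_eta.sub h.contDiffOn_eta)
    (fun t ht θ => by
      have hd := ((contDiff_slice h.contDiffOn_eta ht).differentiable one_ne_zero θ).hasDerivAt
      have hd' := ((contDiff_slice h'.contDiffOn_eta ht).differentiable one_ne_zero θ).hasDerivAt
      convert! (h'.evolution t ht θ).sub (h.evolution t ht θ) using 1
      rw [hH t ht θ, (hd'.fun_sub hd).deriv, linOp, linOp]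
      ring)
    hv (fun t ht => by simp only [h'.gauge t ht, h.gauge t ht, sub_self])
    (by
      filter_upwards [h.initial, h'.initial] with θ h1 h2
      simp [h1, h2])
  intro t ht θ
  refine ⟨sub_eq_zero.1 (hη t ht θ), ?_⟩
  -- Once the `η` components agree, the velocities differ by a constant in `θ`, and the gauge makes
  -- it zero.
  have hz (θ : ℝ) : hilbertInt (fun θ => η' t θ - η t θ) θ = 0 := by
    simp [hilbertInt, hη t ht]
  have hc := is_const_of_deriv_eq_zero (f := fun θ => v' t θ - v t θ)
    (fun θ => (hv t ht θ).differentiableAt) (fun θ => by rw [(hv t ht θ).deriv, hz θ]) θ 0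
  simp only [h'.gauge t ht, h.gauge t ht, sub_self] at hc
  exact sub_eq_zero.1 hc

/-- One Fourier evolution at level `m = n + 4` provides all the claims, read at different levels of
the scale. -/
theorem exists_classicalSolution (n : ℕ) (η₀ : Sobolev (n + 4)) (T : ℝ) :
    ∃ η v : ℝ → ℝ → ℝ, IsClassicalSolution T η₀ η v ∧ MemCkSobolev 0 (n + 4) T η ∧
      MemCkSobolev 2 (n + 2) T η := by
  obtain ⟨y₀, hy₀⟩ := exists_wt_eq_coeffSeq η₀
  obtain ⟨y, hy, hy0, hd⟩ := exists_seq_evolution (n + 4) y₀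
  have hs (t : ℝ) : Summable fun k => rho k * ‖wt (n + 4) (y t) k‖ :=
    summable_rho_mul_wt (by lia) (y t)
  refine ⟨fun t => trigSeries (wt (n + 4) (y t)), fun t θ =>
    trigSeries (velSeq (wt (n + 4) (y t))) θ - trigSeries (velSeq (wt (n + 4) (y t))) 0, ?_, ?_, ?_⟩
  · refine ⟨fun t _ => trigSeries_periodic _, fun t _ θ => ?_, ?_, fun t _ θ => ?_,
      fun t _ θ => ?_, fun t _ θ => ?_, fun t _ => sub_self _, ?_⟩
    · simp only [trigSeries_periodic _ θ]
    -- One of the `n + 4` weights is spent on differentiability in time, and the other `n + 3` on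
    -- `C¹` evaluation in `θ`.
    · have := contDiff_trigSeries_wt (n := n) (contDiff_wt_one hy hd)
      simp only [wt_add_apply] at this
      exact this.contDiffOn
    · exact (hasDerivAt_evolution hd t θ).hasDerivWithinAt
    · have := hasHilbertAt_trigSeries (hs t) θ
      rwa [this.hilbert_eq]
    · rw [(hasHilbertAt_trigSeries (hs t) θ).hilbert_eq]
      exact hasDerivAt_velSeq (hs t) θ
    · have h1 := synth_ae_eq_trigSeries (summable_norm_of_rho' (hs 0))
      rw [hy0, hy₀, synth_coeffSeq] at h1
      rw [hy0, hy₀]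
      exact h1.symm
  · refine ⟨fun t => toSobolev (n + 4) (y t), ?_, fun t _ =>
      toSobolev_toFun (summable_norm_of_rho' (hs t))⟩
    rw [Nat.cast_zero, contDiffOn_zero]
    exact ((toSobolev (n + 4)).continuous.comp hy).continuousOn
  -- The same function, read at level `n + 2`, has coordinates `wt 2 (y t)`, and this curve is `C²`.
  · have e (t : ℝ) : wt (n + 2) (wt 2 (y t)) = wt (n + 4) (y t) := wt_add_apply _ _ _
    refine ⟨fun t => toSobolev (n + 2) (wt 2 (y t)), ?_, fun t _ => ?_⟩
    · exact ((toSobolev (n + 2)).contDiff.comp (contDiff_wt_two hy hd)).contDiffOn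
    · have := toSobolev_toFun (s := n + 2) (y := wt 2 (y t))
        (by rw [e]; exact summable_norm_of_rho' (hs t))
      rwa [e] at this

end WellPosedness

end DeGregorio

end

theorem theorem1 (m : ℕ) (hm : 3 < m) (η₀ : DeGregorio.Sobolev m) (T : ℝ) (hT : 0 < T) :
    ∃ η v : ℝ → ℝ → ℝ,
      DeGregorio.IsClassicalSolution T η₀ η v ∧
      DeGregorio.MemCkSobolev 0 m T η ∧
      DeGregorio.MemCkSobolev 2 (m - 2) T η ∧
      ∀ η' v' : ℝ → ℝ → ℝ, DeGregorio.IsClassicalSolution T η₀ η' v' →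
        ∀ t ∈ Set.Icc 0 T, ∀ θ : ℝ, η' t θ = η t θ ∧ v' t θ = v t θ := by
  obtain ⟨n, rfl⟩ : ∃ n, m = n + 4 := ⟨m - 4, by lia⟩
  obtain ⟨η, v, h, h0, h2⟩ := DeGregorio.exists_classicalSolution n η₀ T
  exact ⟨η, v, h, h0, h2, fun η' v' h' => h.unique hT h'⟩
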